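/- For integers $m,n\ge 1$ let $M^t(n,2m)$ be the following graph (the $3^3.4^2$ lattice with toroidal boundary condition). Its vertices are the pairs $(r,c)$ with $r\in\mathbb Z/2m$ (the row, numbered from bottom to top) and $c\in\mathbb Z/n$ (the column, numbered from left to right). Its edges are the edges $\{(r,c),(r,c+1)\}$ and $\{(r,c),(r+1,c)\}$ of the $2m\times n$ toroidal square lattice and, for $r\in\{0,2,\dots,2m-2\}$, the diagonals $\{(r,c+1),(r+1,c)\}$ joining the upper left to the lower right corner of each square in every other row of squares. (Loops and multiplicities, which arise only for very small $m,n$, are discarded.) Call the edges that join row $2m-1$ to row $0$ vertical wrap-around edges, and the edges, diagonals included, that join column $n-1$ to column $0$ across the boundary horizontal wrap-around edges. Let $M^c(n,2m)$ (cylindrical boundary condition) be the graph obtained like $M^t(n,2m)$ but without the wrap-around edges in one of the two directions, fixed once and for all (the statements below hold for either choice of the direction), and let $M^f(n,2m)$ (free boundary condition) be the graph without wrap-around edges in both directions. For a graph $G$ with $N$ vertices and Laplacian eigenvalues $\mu_1\ge\mu_2\ge\cdots\ge\mu_N$ put $LEL(G)=\sum_{i=1}^{N-1}\sqrt{\mu_i}$.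 Let $$I=\frac12\int_0^1\!\int_0^1\sqrt{5-2\cos 2\pi x-S(x,y)}\;dy\,dx+\frac12\int_0^1\!\int_0^1\sqrt{5-2\cos 2\pi x+S(x,y)}\;dy\,dx,$$ where $S(x,y)=\sqrt{3+2\cos 2\pi x+2\cos 2\pi y+2\cos 2\pi(x+y)}$. Theorem 4.7. 1. The following iterated limits exist (for the inner ones: for all sufficiently large $m$) and $$\lim_{m\to\infty}\lim_{n\to\infty}\frac{LEL(M^t(n,2m))}{2mn}=\lim_{m\to\infty}\lim_{n\to\infty}\frac{LEL(M^c(n,2m))}{2mn}=\lim_{m\to\infty}\lim_{n\to\infty}\frac{LEL(M^f(n,2m))}{2mn}=I\approx 2.1525,$$ that is, $|I-2.1525|<0.00005$. 2. As $m$ and $n$ both tend to infinity (independently of each other), each of $LEL(M^t(n,2m))$, $LEL(M^c(n,2m))$ and $LEL(M^f(n,2m))$ is asymptotically equivalent to $2I\,mn$ (the quotient tends to $1$), where $2I\approx 4.3050$, that is, $|2I-4.3050|<0.0001$. -/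

import Mathlib

open Filter Topology Asymptotics

/-- The Laplacian-energy-like invariant of a finite graph on `N` vertices: the sum of the square
roots of the `N - 1` largest Laplacian eigenvalues. Mathlib's `eigenvalues₀` lists the eigenvalues
with multiplicity in weakly decreasing order, so the index `N - 1` (counting from `0`), which is
left out, is that of a smallest eigenvalue. -/
noncomputable def laplacianEnergyLike {V : Type*} [Fintype V] [DecidableEq V]
    (G : SimpleGraph V) : ℝ :=
  letI : DecidableRel G.Adj := Classical.decRel G.Adj
  ∑ i : Fin (Fintype.card V) with i.val + 1 < Fintype.card V,
    √((G.posSemidef_lapMatrix ℝ).isHermitian.eigenvalues₀ i)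

/-- `LatticeStep wrap i j`: the position `j` comes directly after `i` among `0, …, k - 1`; if `wrap` is
`true`, then `0` also comes directly after `k - 1`. -/
def LatticeStep {k : ℕ} (wrap : Bool) (i j : Fin k) : Prop :=
  (i : ℕ) + 1 = j ∨ (wrap = true ∧ (i : ℕ) + 1 = k ∧ (j : ℕ) = 0)

/-- The `3³.4²` lattice with `2m` rows and `n` columns. A vertex is a pair (row, column), with row
`0` at the bottom and column `0` at the left. The edges are those of the `2m × n` square lattice
and, in every other row of squares (the squares between the rows `r` and `r + 1` with `r` even),
the diagonal that joins the upper left corner of the square to its lower right corner.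
`vert` says whether the top row is joined to the bottom row, and `horiz` whether the last column
is joined to the first one (by horizontal edges and by diagonals). -/
def lattice3342 (vert horiz : Bool) (n m : ℕ) : SimpleGraph (Fin (2 * m) × Fin n) :=
  SimpleGraph.fromRel fun p q =>
    (p.1 = q.1 ∧ LatticeStep horiz p.2 q.2) ∨
    (p.2 = q.2 ∧ LatticeStep vert p.1 q.1) ∨
    (Even (p.1 : ℕ) ∧ (p.1 : ℕ) + 1 = q.1 ∧ LatticeStep horiz q.2 p.2)

/-- `Mᵗ(n, 2m)`: toroidal boundary condition. -/
def latticeToroidal (n m : ℕ) : SimpleGraph (Fin (2 * m) × Fin n) := lattice3342 true true n m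

/-- `Mᶜ(n, 2m)`: cylindrical boundary condition; the edges between the top row and the bottom row
are deleted. -/
def latticeCylindrical (n m : ℕ) : SimpleGraph (Fin (2 * m) × Fin n) := lattice3342 false true n m

/-- The other cylinder: the edges between the last column and the first column are deleted. -/
def latticeCylindrical' (n m : ℕ) : SimpleGraph (Fin (2 * m) × Fin n) := lattice3342 true false n m

/-- `Mᶠ(n, 2m)`: free boundary condition. -/
def latticeFree (n m : ℕ) : SimpleGraph (Fin (2 * m) × Fin n) := lattice3342 false false n m

/-- The iterated limit `lim_{m → ∞} lim_{n → ∞} f m n` exists and is `l`. -/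
def HasIteratedLimit (f : ℕ → ℕ → ℝ) (l : ℝ) : Prop :=
  ∃ g : ℕ → ℝ, (∀ᶠ m in atTop, Tendsto (fun n => f m n) atTop (𝓝 (g m))) ∧
    Tendsto g atTop (𝓝 l)

/-- The inner square root in the Laplacian eigenvalues. -/
noncomputable def innerRoot (x y : ℝ) : ℝ :=
  √(3 + 2 * Real.cos (2 * Real.pi * x) + 2 * Real.cos (2 * Real.pi * y)
    + 2 * Real.cos (2 * Real.pi * (x + y)))

/-- The explicit limiting Laplacian-energy-like per vertex. -/
noncomputable def limitPerVertex : ℝ :=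
  1 / 2 * (∫ x in (0 : ℝ)..1, ∫ y in (0 : ℝ)..1,
      √(5 - 2 * Real.cos (2 * Real.pi * x) - innerRoot x y)) +
  1 / 2 * (∫ x in (0 : ℝ)..1, ∫ y in (0 : ℝ)..1,
      √(5 - 2 * Real.cos (2 * Real.pi * x) + innerRoot x y))

/-! ### One-sided quadrature for powers of the cosine -/

/-! The limit is the mean of the square root over the limiting spectral distribution, which is
identified by its moments. For m ≥ 2 and n ≥ 3 all absolute row sums of the Laplacians are at most
10, so the spectra lie in [0, 10], and by Weierstrass approximation only the normalized traces of
powers matter (`tendsto_mean_sub_mean`). On the torus, a Fourier transform along the columns and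
then along pairs of rows writes such a trace as a sum over characters of traces of 2 × 2 matrices,
whose eigenvalues are the two radicands in the integrals (`trace_torus_pow`); normalized, this is a
Riemann sum. The other boundary conditions alter only O(m + n) of the 2mn rows of the Laplacian and
hence the trace of a fixed power by O(m + n) (`abs_trace_sub_torus_le`). This gives the joint limit
and with it the asymptotic equivalence.

An iterated limit also requires the inner limits. At fixed m the vertical boundary may not be
periodic, so only the Fourier transform along the columns is available; the trace is still a Riemann
sum in the one remaining variable (`exists_tendsto_spectralMean_pow`), and cutting the horizontal
wrap-around edges touches O(m) rows.

The numerical value comes from a two-sided quadrature without error term. In p = cos πx and q =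
cos(2πy + πx) the integrand is the mean of √(7 - 4p² ± R) with R² = 1 + 4p² + 4pq. It equals √10 (1
- u), where u is a limit of polynomials in p and q with nonnegative coefficients: 1 - √(1 - x) has
such an expansion, the odd powers of R cancel between the two branches, and R² itself has
nonnegative coefficients. A rule that overestimates the moments of the cosine therefore
underestimates the integral, and conversely. The trapezoidal rule overestimates them
(`avgInt_cos_pow_le_avgTrap`) and the midpoint rule underestimates them
(`avgMid_cos_pow_le_avgInt`), so two finite sums enclose the value; they are evaluated in exact
integer arithmetic. -/

theorem le_of_halfSum_recurrence {a b : ℕ → ℤ → ℝ}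
    (ha : ∀ k w, a (k + 1) w = (a k (w + 1) + a k (w - 1)) / 2)
    (hb : ∀ k w, b (k + 1) w = (b k (w + 1) + b k (w - 1)) / 2)
    (h0 : ∀ w, a 0 w ≤ b 0 w) (k : ℕ) (w : ℤ) : a k w ≤ b k w := by
  induction k generalizing w with
  | zero => exact h0 w
  | succ k ih => rw [ha, hb]; linarith [ih (w + 1), ih (w - 1)]

/-- Discrete maximum principle for the half-sum recurrence on `0, …, M` with even reflection at
`0` and a sign condition at `M`. -/
theorem nonneg_of_halfSum_recurrence {a : ℕ → ℤ → ℝ} {M : ℤ} (hM : 1 ≤ M)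
    (ha : ∀ k w, a (k + 1) w = (a k (w + 1) + a k (w - 1)) / 2)
    (heven : ∀ k w, a k (-w) = a k w)
    (h0 : ∀ w, 0 ≤ w → w ≤ M → 0 ≤ a 0 w) (hbd : ∀ k, 0 ≤ a k M)
    (k : ℕ) (w : ℤ) (hw : 0 ≤ w) (hwM : w ≤ M) : 0 ≤ a k w := by
  induction k generalizing w with
  | zero => exact h0 w hw hwM
  | succ k ih =>
    rcases hwM.eq_or_lt with rfl | hlt
    · exact hbd _
    · rw [ha]
      have h1 := ih (w + 1) (by omega) (by omega)
      have h2 : 0 ≤ a k (w - 1) := by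
        -- At w = 0 the neighbour -1 is the mirror image of 1.
        rcases hw.eq_or_lt with rfl | hpos
        · have := ih 1 (by omega) hM
          rw [← heven] at this
          simpa using this
        · exact ih (w - 1) (by omega) (by omega)
      linarith

/-- The average over the half circle. -/
noncomputable def avgInt (f : ℝ → ℝ) : ℝ := ∫ x in (0 : ℝ)..1, f (Real.pi * x)

/-- The midpoint rule on the half circle with `M` nodes. -/
noncomputable def avgMid (M : ℕ) (f : ℝ → ℝ) : ℝ :=
  (∑ j ∈ Finset.range M, f ((2 * j + 1 : ℕ) * (Real.pi / (2 * M)))) / M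

/-- The trapezoidal rule on the half circle with `M` subintervals. -/
noncomputable def avgTrap (M : ℕ) (f : ℝ → ℝ) : ℝ :=
  (∑ j ∈ Finset.range M, (f (j * (Real.pi / M)) + f ((j + 1 : ℕ) * (Real.pi / M)))) / (2 * M)

/-- Product-to-sum. Each of the three averages inherits a half-sum recurrence in k from this, so
that moments can be compared through their values at k = 0. -/
theorem cos_pow_succ_mul_cos (k : ℕ) (w : ℤ) (t : ℝ) :
    Real.cos t ^ (k + 1) * Real.cos (w * t) =
      (Real.cos t ^ k * Real.cos ((w + 1 : ℤ) * t) +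
        Real.cos t ^ k * Real.cos ((w - 1 : ℤ) * t)) / 2 := by
  have h1 : Real.cos ((w + 1 : ℤ) * t)
      = Real.cos (w * t) * Real.cos t - Real.sin (w * t) * Real.sin t := by
    rw [← Real.cos_add]; congr 1; push_cast; ring
  have h2 : Real.cos ((w - 1 : ℤ) * t)
      = Real.cos (w * t) * Real.cos t + Real.sin (w * t) * Real.sin t := by
    rw [← Real.cos_sub]; congr 1; push_cast; ring
  rw [h1, h2]; ring

theorem avgInt_recurrence (k : ℕ) (w : ℤ) :
    avgInt (fun t => Real.cos t ^ (k + 1) * Real.cos (w * t)) =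
      (avgInt (fun t => Real.cos t ^ k * Real.cos ((w + 1 : ℤ) * t)) +
        avgInt (fun t => Real.cos t ^ k * Real.cos ((w - 1 : ℤ) * t))) / 2 := by
  simp only [avgInt, cos_pow_succ_mul_cos]
  rw [intervalIntegral.integral_div, intervalIntegral.integral_add]
  · exact Continuous.intervalIntegrable (by fun_prop) _ _
  · exact Continuous.intervalIntegrable (by fun_prop) _ _

theorem avgMid_recurrence (M k : ℕ) (w : ℤ) :
    avgMid M (fun t => Real.cos t ^ (k + 1) * Real.cos (w * t)) =
      (avgMid M (fun t => Real.cos t ^ k * Real.cos ((w + 1 : ℤ) * t)) +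
        avgMid M (fun t => Real.cos t ^ k * Real.cos ((w - 1 : ℤ) * t))) / 2 := by
  simp only [avgMid, cos_pow_succ_mul_cos]
  rw [← Finset.sum_div, Finset.sum_add_distrib]
  ring

theorem avgTrap_recurrence (M k : ℕ) (w : ℤ) :
    avgTrap M (fun t => Real.cos t ^ (k + 1) * Real.cos (w * t)) =
      (avgTrap M (fun t => Real.cos t ^ k * Real.cos ((w + 1 : ℤ) * t)) +
        avgTrap M (fun t => Real.cos t ^ k * Real.cos ((w - 1 : ℤ) * t))) / 2 := by
  simp only [avgTrap, cos_pow_succ_mul_cos]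
  rw [← add_div, div_right_comm, ← Finset.sum_add_distrib, Finset.sum_div _ _ (2 : ℝ)]
  congr 1
  exact Finset.sum_congr rfl fun _ _ => by ring

theorem avgInt_cos (w : ℤ) : avgInt (fun t => Real.cos (w * t)) = if w = 0 then 1 else 0 := by
  split_ifs with h
  · simp [avgInt, h]
  · have hw : (w : ℝ) * Real.pi ≠ 0 := by
      have := Real.pi_ne_zero; have : (w : ℝ) ≠ 0 := by exact_mod_cast h
      positivity
    simp only [avgInt, ← mul_assoc]
    rw [intervalIntegral.integral_comp_mul_left (fun x => Real.cos x) hw]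
    simp [Real.sin_int_mul_pi]

theorem avgMid_cos_zero {M : ℕ} (hM : 0 < M) : avgMid M (fun t => Real.cos ((0 : ℤ) * t)) = 1 := by
  have : (M : ℝ) ≠ 0 := by positivity
  simp [avgMid, this]

/-- Multiplication by sin φ, φ = wπ/(2M), telescopes the sum to sin(wπ)/2 = 0, and the range of w
keeps sin φ nonzero. At w = 2M the value would be -1, so the midpoint rule cannot be compared for
all frequencies at once. -/
theorem avgMid_cos {M : ℕ} (w : ℤ) (hw : 0 < w) (hwM : w < 2 * M) :
    avgMid M (fun t => Real.cos (w * t)) = 0 := by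
  have hM : 0 < M := by omega
  have hM' : (0 : ℝ) < M := by positivity
  have hw' : (0 : ℝ) < w := by exact_mod_cast hw
  have hwM' : (w : ℝ) < 2 * M := by exact_mod_cast hwM
  set φ : ℝ := w * (Real.pi / (2 * M)) with hφ
  have hs : 0 < Real.sin φ := by
    apply Real.sin_pos_of_pos_of_lt_pi
    · have := Real.pi_pos; positivity
    · rw [hφ, ← mul_div_assoc, div_lt_iff₀ (by positivity)]
      nlinarith [Real.pi_pos]
  have key : ∀ n : ℕ, Real.sin φ * ∑ j ∈ Finset.range n,
      Real.cos (w * ((2 * j + 1 : ℕ) * (Real.pi / (2 * M)))) = Real.sin (2 * n * φ) / 2 := by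
    intro n
    induction n with
    | zero => simp
    | succ n ih =>
      rw [Finset.sum_range_succ, mul_add, ih]
      have e1 : w * ((2 * n + 1 : ℕ) * (Real.pi / (2 * M))) = 2 * n * φ + φ := by
        rw [hφ]; push_cast; ring
      have e2 : 2 * ((n + 1 : ℕ) : ℝ) * φ = (2 * n * φ + φ) + φ := by push_cast; ring
      have e3 : 2 * (n : ℝ) * φ = (2 * n * φ + φ) - φ := by ring
      rw [e1, e2]
      nth_rw 1 [e3]
      rw [Real.sin_add (2 * n * φ + φ), Real.sin_sub (2 * n * φ + φ)]
      ring
  have h := key M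
  have e : 2 * (M : ℝ) * φ = w * Real.pi := by rw [hφ]; field_simp
  rw [e, Real.sin_int_mul_pi, zero_div] at h
  rcases mul_eq_zero.1 h with h | h
  · exact absurd h hs.ne'
  · rw [avgMid, h, zero_div]

/-- The nodes are zeros of cos(Mt). This supplies the boundary value at w = M for the maximum
principle. -/
theorem avgMid_pow_mul_cos_eq_zero {M : ℕ} (hM : 0 < M) (k : ℕ) :
    avgMid M (fun t => Real.cos t ^ k * Real.cos ((M : ℤ) * t)) = 0 := by
  have hM' : (M : ℝ) ≠ 0 := by positivity
  rw [avgMid, Finset.sum_eq_zero, zero_div]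
  intro j _
  have : ((M : ℤ) : ℝ) * ((2 * j + 1 : ℕ) * (Real.pi / (2 * M))) = (j : ℤ) * Real.pi + Real.pi / 2 := by
    push_cast; field_simp
  simp only [this, Real.cos_add_pi_div_two, Real.sin_int_mul_pi]
  simp

/-- Here aliasing only ever adds: the telescoped sum vanishes unless sin φ = 0, and in that case the
cosine is 1 at every node. -/
theorem avgTrap_cos_nonneg {M : ℕ} (hM : 0 < M) (w : ℤ) :
    0 ≤ avgTrap M (fun t => Real.cos (w * t)) := by
  have hM' : (M : ℝ) ≠ 0 := by positivity
  set φ : ℝ := w * (Real.pi / M) / 2 with hφ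
  have key : ∀ n : ℕ, Real.sin φ * ∑ j ∈ Finset.range n,
      (Real.cos (w * (j * (Real.pi / M))) + Real.cos (w * ((j + 1 : ℕ) * (Real.pi / M))))
        = Real.cos φ * Real.sin (2 * n * φ) := by
    intro n
    induction n with
    | zero => simp
    | succ n ih =>
      rw [Finset.sum_range_succ, mul_add, ih]
      have e1 : w * ((n : ℝ) * (Real.pi / M)) = (2 * n * φ + φ) - φ := by
        rw [hφ]; ring
      have e2 : w * ((n + 1 : ℕ) * (Real.pi / M)) = (2 * n * φ + φ) + φ := by
        rw [hφ]; push_cast; ring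
      have e3 : 2 * ((n + 1 : ℕ) : ℝ) * φ = (2 * n * φ + φ) + φ := by push_cast; ring
      have e4 : 2 * (n : ℝ) * φ = (2 * n * φ + φ) - φ := by ring
      rw [e1, e2, e3]
      nth_rw 1 [e4]
      rw [Real.sin_add (2 * n * φ + φ), Real.sin_sub (2 * n * φ + φ),
        Real.cos_add (2 * n * φ + φ), Real.cos_sub (2 * n * φ + φ)]
      ring
  have h := key M
  have e : 2 * (M : ℝ) * φ = w * Real.pi := by rw [hφ]; field_simp
  rw [e, Real.sin_int_mul_pi, mul_zero] at h
  rw [avgTrap]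
  apply div_nonneg _ (by positivity)
  rcases mul_eq_zero.1 h with h | h
  · obtain ⟨l, hl⟩ := Real.sin_eq_zero_iff.1 h
    refine Finset.sum_nonneg fun j _ => ?_
    have e1 : w * ((j : ℝ) * (Real.pi / M)) = ((j * l : ℤ) : ℝ) * (2 * Real.pi) := by
      push_cast; linear_combination (-2 * (j : ℝ)) * hl + 2 * j * hφ
    have e2 : w * ((j + 1 : ℕ) * (Real.pi / M)) = (((j + 1) * l : ℤ) : ℝ) * (2 * Real.pi) := by
      push_cast; linear_combination (-2 * ((j : ℝ) + 1)) * hl + 2 * (j + 1) * hφ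
    rw [e1, e2, Real.cos_int_mul_two_pi, Real.cos_int_mul_two_pi]
    norm_num
  · rw [h]

theorem avgTrap_cos_zero {M : ℕ} (hM : 0 < M) :
    avgTrap M (fun t => Real.cos ((0 : ℤ) * t)) = 1 := by
  have : (M : ℝ) ≠ 0 := by positivity
  simp [avgTrap]
  field_simp
  norm_num

theorem avgInt_cos_pow_nonneg (k : ℕ) (w : ℤ) :
    0 ≤ avgInt (fun t => Real.cos t ^ k * Real.cos (w * t)) := by
  refine le_of_halfSum_recurrence (a := fun _ _ => 0)
    (b := fun k w => avgInt (fun t => Real.cos t ^ k * Real.cos (w * t)))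
    (by simp) avgInt_recurrence ?_ k w
  intro w
  simp only [pow_zero, one_mul]
  rw [avgInt_cos]
  split_ifs <;> norm_num

/-- At k = 0 the integral is the Kronecker delta in w, which the trapezoidal rule matches at w = 0
and dominates elsewhere. The recurrence preserves the order; the moment is the entry at w = 0. -/
theorem avgInt_cos_pow_le_avgTrap {M : ℕ} (hM : 0 < M) (k : ℕ) :
    avgInt (fun t => Real.cos t ^ k) ≤ avgTrap M (fun t => Real.cos t ^ k) := by
  have := le_of_halfSum_recurrence
    (a := fun k w => avgInt (fun t => Real.cos t ^ k * Real.cos (w * t)))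
    (b := fun k w => avgTrap M (fun t => Real.cos t ^ k * Real.cos (w * t)))
    avgInt_recurrence (avgTrap_recurrence M) (fun w => ?_) k 0
  · simpa using this
  · simp only [pow_zero, one_mul]
    rw [avgInt_cos]
    split_ifs with h
    · rw [h, avgTrap_cos_zero hM]
    · exact avgTrap_cos_nonneg hM w

theorem avgMid_even (M k : ℕ) (w : ℤ) :
    avgMid M (fun t => Real.cos t ^ k * Real.cos ((-w : ℤ) * t)) =
      avgMid M (fun t => Real.cos t ^ k * Real.cos (w * t)) := by
  simp [avgMid]

theorem avgInt_even (k : ℕ) (w : ℤ) :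
    avgInt (fun t => Real.cos t ^ k * Real.cos ((-w : ℤ) * t)) =
      avgInt (fun t => Real.cos t ^ k * Real.cos (w * t)) := by
  simp [avgInt]

theorem avgMid_cos_eq_avgInt_cos {M : ℕ} (hM : 0 < M) (w : ℤ) (hw : 0 ≤ w) (hwM : w ≤ M) :
    avgMid M (fun t => Real.cos (w * t)) = avgInt (fun t => Real.cos (w * t)) := by
  rw [avgInt_cos]
  split_ifs with h
  · rw [h, avgMid_cos_zero hM]
  · exact avgMid_cos w (by omega) (by omega)

theorem avgMid_cos_pow_nonneg {M : ℕ} (hM : 0 < M) (k : ℕ) :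
    0 ≤ avgMid M (fun t => Real.cos t ^ k) := by
  have := nonneg_of_halfSum_recurrence (M := M) (by omega)
    (a := fun k w => avgMid M (fun t => Real.cos t ^ k * Real.cos (w * t))) (avgMid_recurrence M) (avgMid_even M)
    (fun w hw hwM => ?_) (fun k => (avgMid_pow_mul_cos_eq_zero hM k).ge) k 0 le_rfl (by omega)
  · simpa using this
  · simp only [pow_zero, one_mul]
    rw [avgMid_cos_eq_avgInt_cos hM w hw hwM, avgInt_cos]
    split_ifs <;> norm_num

/-- The difference satisfies the recurrence, vanishes on 0, …, M at k = 0, and at w = M reduces to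
the nonnegative integral; the maximum principle applies. -/
theorem avgMid_cos_pow_le_avgInt {M : ℕ} (hM : 0 < M) (k : ℕ) :
    avgMid M (fun t => Real.cos t ^ k) ≤ avgInt (fun t => Real.cos t ^ k) := by
  have := nonneg_of_halfSum_recurrence (M := M) (by omega)
    (a := fun k w => avgInt (fun t => Real.cos t ^ k * Real.cos (w * t)) -
      avgMid M (fun t => Real.cos t ^ k * Real.cos (w * t)))
    (fun k w => by simp only [avgInt_recurrence, avgMid_recurrence]; ring)
    (fun k w => by simp only [avgInt_even, avgMid_even])
    (fun w hw hwM => ?_) (fun k => ?_) k 0 le_rfl (by omega)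
  · simpa using this
  · simp only [pow_zero, one_mul]
    rw [avgMid_cos_eq_avgInt_cos hM w hw hwM, sub_self]
  · simp only [avgMid_pow_mul_cos_eq_zero hM, sub_zero]
    exact avgInt_cos_pow_nonneg k M

/-! ### Comparison of averages on functions whose expansion has nonnegative coefficients -/

/-- A normalized positive functional on continuous functions, continuous in parameters. -/
structure IsAverage (E : (ℝ → ℝ) → ℝ) : Prop where
  one : E (fun _ => 1) = 1
  add : ∀ f g : ℝ → ℝ, Continuous f → Continuous g → E (fun t => f t + g t) = E f + E g
  const_mul : ∀ (c : ℝ) (f : ℝ → ℝ), Continuous f → E (fun t => c * f t) = c * E f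
  mono : ∀ f g : ℝ → ℝ, Continuous f → Continuous g → (∀ t, f t ≤ g t) → E f ≤ E g
  continuous : ∀ f : ℝ → ℝ → ℝ, Continuous (Function.uncurry f) → Continuous fun s => E (f s)

theorem isAverage_avgInt : IsAverage avgInt where
  one := by simp [avgInt]
  add f g hf hg := by
    simp only [avgInt]
    exact intervalIntegral.integral_add (Continuous.intervalIntegrable (by fun_prop) _ _)
      (Continuous.intervalIntegrable (by fun_prop) _ _)
  const_mul c f hf := by simp [avgInt]
  mono f g hf hg h := by
    simp only [avgInt]
    exact intervalIntegral.integral_mono zero_le_one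
      (Continuous.intervalIntegrable (by fun_prop) _ _)
      (Continuous.intervalIntegrable (by fun_prop) _ _) fun t => h _
  continuous f hf := by
    simp only [avgInt]
    exact intervalIntegral.continuous_parametric_intervalIntegral_of_continuous'
      (f := fun s t => f s (Real.pi * t))
      (hf.comp (continuous_fst.prodMk (continuous_const.mul continuous_snd))) _ _

theorem isAverage_avgMid {M : ℕ} (hM : 0 < M) : IsAverage (avgMid M) where
  one := by
    have : (M : ℝ) ≠ 0 := by positivity
    simp [avgMid, this]
  add f g _ _ := by simp only [avgMid, Finset.sum_add_distrib, add_div]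
  const_mul c f _ := by simp only [avgMid, ← Finset.mul_sum, mul_div_assoc]
  mono f g _ _ h := by
    simp only [avgMid]
    exact div_le_div_of_nonneg_right (Finset.sum_le_sum fun j _ => h _) (by positivity)
  continuous f hf := by
    simp only [avgMid]
    refine Continuous.div_const (continuous_finsetSum _ fun j _ => ?_) _
    exact hf.comp (continuous_id.prodMk continuous_const)

theorem isAverage_avgTrap {M : ℕ} (hM : 0 < M) : IsAverage (avgTrap M) where
  one := by simpa using avgTrap_cos_zero hM
  add f g _ _ := by
    simp only [avgTrap, ← add_div, ← Finset.sum_add_distrib]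
    congr 1
    exact Finset.sum_congr rfl fun _ _ => by ring
  const_mul c f _ := by simp only [avgTrap, ← mul_add, ← Finset.mul_sum, mul_div_assoc]
  mono f g _ _ h := by
    simp only [avgTrap]
    exact div_le_div_of_nonneg_right (Finset.sum_le_sum fun j _ => add_le_add (h _) (h _))
      (by positivity)
  continuous f hf := by
    simp only [avgTrap]
    refine Continuous.div_const (continuous_finsetSum _ fun j _ => Continuous.add ?_ ?_) _
    · exact hf.comp (continuous_id.prodMk continuous_const)
    · exact hf.comp (continuous_id.prodMk continuous_const)

/-- The double average of a function of two cosines. -/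
noncomputable def doubleAverage (E E' : (ℝ → ℝ) → ℝ) (f : ℝ → ℝ → ℝ) : ℝ :=
  E fun s => E' fun t => f (Real.cos s) (Real.cos t)

section
variable {E E' : (ℝ → ℝ) → ℝ} {f g : ℝ → ℝ → ℝ}

theorem continuous_cos_section (hf : Continuous (Function.uncurry f)) (s : ℝ) :
    Continuous fun t => f s (Real.cos t) :=
  hf.comp (continuous_const.prodMk Real.continuous_cos)

theorem IsAverage.continuous_inner (hE' : IsAverage E') (hf : Continuous (Function.uncurry f)) :
    Continuous fun s => E' fun t => f (Real.cos s) (Real.cos t) :=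
  hE'.continuous (fun s t => f (Real.cos s) (Real.cos t))
    (hf.comp ((Real.continuous_cos.comp continuous_fst).prodMk
      (Real.continuous_cos.comp continuous_snd)))

theorem doubleAverage_add (hE : IsAverage E) (hE' : IsAverage E')
    (hf : Continuous (Function.uncurry f)) (hg : Continuous (Function.uncurry g)) :
    doubleAverage E E' (fun p q => f p q + g p q) =
      doubleAverage E E' f + doubleAverage E E' g := by
  simp only [doubleAverage]
  rw [← hE.add _ _ (hE'.continuous_inner hf) (hE'.continuous_inner hg)]
  congr 1; ext s
  exact hE'.add _ _ (continuous_cos_section hf _) (continuous_cos_section hg _)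

theorem doubleAverage_const_mul (hE : IsAverage E) (hE' : IsAverage E')
    (hf : Continuous (Function.uncurry f)) (c : ℝ) :
    doubleAverage E E' (fun p q => c * f p q) = c * doubleAverage E E' f := by
  simp only [doubleAverage]
  rw [← hE.const_mul _ _ (hE'.continuous_inner hf)]
  congr 1; ext s
  exact hE'.const_mul _ _ (continuous_cos_section hf _)

theorem doubleAverage_const (hE : IsAverage E) (hE' : IsAverage E') (c : ℝ) :
    doubleAverage E E' (fun _ _ => c) = c := by
  have h1 : ∀ {E : (ℝ → ℝ) → ℝ}, IsAverage E → E (fun _ => c) = c := fun {E} hE => by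
    simpa [hE.one] using hE.const_mul c (fun _ => 1) continuous_const
  rw [doubleAverage, h1 hE', h1 hE]

theorem doubleAverage_mono (hE : IsAverage E) (hE' : IsAverage E')
    (hf : Continuous (Function.uncurry f)) (hg : Continuous (Function.uncurry g))
    (h : ∀ p q, |p| ≤ 1 → |q| ≤ 1 → f p q ≤ g p q) :
    doubleAverage E E' f ≤ doubleAverage E E' g :=
  hE.mono _ _ (hE'.continuous_inner hf) (hE'.continuous_inner hg) fun _ =>
    hE'.mono _ _ (continuous_cos_section hf _) (continuous_cos_section hg _) fun _ =>
      h _ _ (Real.abs_cos_le_one _) (Real.abs_cos_le_one _)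

end

/-- Monomials in two variables with a nonnegative coefficient. -/
def nonnegMonomials : Submonoid (ℝ → ℝ → ℝ) where
  carrier := {f | ∃ (r : ℝ) (i j : ℕ), 0 ≤ r ∧ f = fun p q => r * (p ^ i * q ^ j)}
  one_mem' := ⟨1, 0, 0, zero_le_one, by ext; simp⟩
  mul_mem' := by
    rintro _ _ ⟨r, i, j, hr, rfl⟩ ⟨r', i', j', hr', rfl⟩
    exact ⟨r * r', i + i', j + j', mul_nonneg hr hr', by ext; simp; ring⟩

/-- Polynomials in two variables with nonnegative coefficients. -/
def nonnegPolynomials : Subsemiring (ℝ → ℝ → ℝ) := nonnegMonomials.subsemiringClosure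

theorem monomial_mem_nonnegPolynomials {r : ℝ} (hr : 0 ≤ r) (i j : ℕ) :
    (fun p q => r * (p ^ i * q ^ j)) ∈ nonnegPolynomials :=
  AddSubmonoid.subset_closure ⟨r, i, j, hr, rfl⟩

/-- The double average of a monomial factors into two moments of the cosine, so the comparison is
termwise. Nonnegativity of the smaller moments allows the two inequalities to be multiplied. -/
theorem nonnegPolynomials_average_le {E₁ E₁' E₂ E₂' : (ℝ → ℝ) → ℝ}
    (h₁ : IsAverage E₁) (h₁' : IsAverage E₁') (h₂ : IsAverage E₂) (h₂' : IsAverage E₂')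
    (h0 : ∀ k : ℕ, 0 ≤ E₁ fun t => Real.cos t ^ k)
    (h0' : ∀ k : ℕ, 0 ≤ E₁' fun t => Real.cos t ^ k)
    (hle : ∀ k : ℕ, (E₁ fun t => Real.cos t ^ k) ≤ E₂ fun t => Real.cos t ^ k)
    (hle' : ∀ k : ℕ, (E₁' fun t => Real.cos t ^ k) ≤ E₂' fun t => Real.cos t ^ k)
    {f : ℝ → ℝ → ℝ} (hf : f ∈ nonnegPolynomials) :
    Continuous (Function.uncurry f) ∧ doubleAverage E₁ E₁' f ≤ doubleAverage E₂ E₂' f := by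
  change f ∈ AddSubmonoid.closure (nonnegMonomials : Set (ℝ → ℝ → ℝ)) at hf
  induction hf using AddSubmonoid.closure_induction with
  | mem f hf =>
    obtain ⟨r, i, j, hr, rfl⟩ := hf
    have hc : Continuous (Function.uncurry fun p q : ℝ => p ^ i * q ^ j) := by
      simp only [Function.uncurry_def]; fun_prop
    refine ⟨by simp only [Function.uncurry_def]; fun_prop, ?_⟩
    have key : ∀ {E E' : (ℝ → ℝ) → ℝ}, IsAverage E → IsAverage E' →
        doubleAverage E E' (fun p q => r * (p ^ i * q ^ j)) =
          r * ((E fun t => Real.cos t ^ i) * E' fun t => Real.cos t ^ j) := by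
      intro E E' hE hE'
      rw [doubleAverage_const_mul hE hE' hc, doubleAverage]
      congr 1
      have : (fun s => E' fun t => Real.cos s ^ i * Real.cos t ^ j) =
          fun s => (E' fun t => Real.cos t ^ j) * Real.cos s ^ i := by
        ext s
        rw [hE'.const_mul _ (fun t => Real.cos t ^ j) (by fun_prop), mul_comm]
      rw [this, hE.const_mul _ (fun t => Real.cos t ^ i) (by fun_prop), mul_comm]
    rw [key h₁ h₁', key h₂ h₂']
    exact mul_le_mul_of_nonneg_left
      (mul_le_mul (hle i) (hle' j) (h0' j) ((h0 i).trans (hle i))) hr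
  | zero =>
    refine ⟨continuous_const, ?_⟩
    have := doubleAverage_const h₁ h₁' 0
    have h' := doubleAverage_const h₂ h₂' 0
    exact (this.trans h'.symm).le
  | add f g _ _ ihf ihg =>
    refine ⟨ihf.1.add ihg.1, ?_⟩
    have e1 := doubleAverage_add h₁ h₁' ihf.1 ihg.1
    have e2 := doubleAverage_add h₂ h₂' ihf.1 ihg.1
    change doubleAverage E₁ E₁' (fun p q => f p q + g p q) ≤
      doubleAverage E₂ E₂' (fun p q => f p q + g p q)
    rw [e1, e2]
    exact add_le_add ihf.2 ihg.2

/-! ### Polynomial approximation of the site density from below -/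

/-- The iteration `q ↦ (x + q²) / 2`, which converges to `1 - √(1 - x)`. -/
noncomputable def sqrtIter : ℕ → ℝ → ℝ
  | 0, _ => 0
  | n + 1, x => (x + sqrtIter n x ^ 2) / 2

/-- With s = √(1 - x), one step turns the error e into e - e²/2 - se. Discarding se gives a bound
uniform up to x = 1, and t - t²/2 increases on [0, 1], so the bound 2/(n + 2) propagates. -/
theorem sqrtIter_bounds {x : ℝ} (h0 : 0 ≤ x) (h1 : x ≤ 1) (n : ℕ) :
    0 ≤ sqrtIter n x ∧ sqrtIter n x ≤ 1 - √(1 - x) ∧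
      1 - √(1 - x) - sqrtIter n x ≤ 2 / (n + 2) := by
  have hs0 := Real.sqrt_nonneg (1 - x)
  have hs := Real.sq_sqrt (sub_nonneg.2 h1)
  have hs1 : √(1 - x) ≤ 1 := by nlinarith
  set s := √(1 - x)
  induction n with
  | zero => simp [sqrtIter]; constructor <;> linarith
  | succ n ih =>
    obtain ⟨a, b, c⟩ := ih
    have hx : x = 1 - s ^ 2 := by linarith
    set y := sqrtIter n x with hy
    have hn : (0 : ℝ) ≤ n := by positivity
    simp only [sqrtIter, ← hy]
    refine ⟨by positivity, by nlinarith, ?_⟩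
    set e := 1 - s - y with he
    have he0 : 0 ≤ e := by linarith
    have heq : 1 - s - (x + y ^ 2) / 2 = e - e ^ 2 / 2 - s * e := by
      rw [he, hx]; ring
    rw [heq]
    set d : ℝ := 2 / (n + 2) with hd
    have hd1 : d ≤ 1 := by rw [hd, div_le_one (by positivity)]; linarith
    have h2 : d - d ^ 2 / 2 ≤ 2 / ((n + 1 : ℕ) + 2) := by
      push_cast
      rw [hd, le_div_iff₀ (by positivity)]
      field_simp
      nlinarith
    -- The second product is (d - e)(2 - d - e) = 2((d - d²/2) - (e - e²/2)).
    nlinarith [mul_nonneg hs0 he0, mul_nonneg (sub_nonneg.2 c) (by linarith : 0 ≤ 2 - d - e)]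

/-- `R²` as a polynomial in the two cosines. -/
def innerSq (p q : ℝ) : ℝ := 1 + 4 * p ^ 2 + 4 * (p * q)

/-- The average of the two branches of the square root of the symbol, as a function of two
cosines. -/
noncomputable def siteDensity (p q : ℝ) : ℝ :=
  (√(7 - 4 * p ^ 2 - √(innerSq p q)) + √(7 - 4 * p ^ 2 + √(innerSq p q))) / 2

/-- The even and the odd part (in `R`) of `sqrtIter n` at `(3 + 4 p² ± R) / 10`. -/
noncomputable def evenOddIter : ℕ → (ℝ → ℝ → ℝ) × (ℝ → ℝ → ℝ)
  | 0 => (0, 0)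
  | n + 1 =>
    (fun p q => ((3 + 4 * p ^ 2) / 10 +
        (evenOddIter n).1 p q ^ 2 + (evenOddIter n).2 p q ^ 2 * innerSq p q) / 2,
      fun p q => (1 / 10 + 2 * (evenOddIter n).1 p q * (evenOddIter n).2 p q) / 2)

/-- Only sums and products of nonnegative constants, p² and pq occur, because R² is itself built
from these. -/
theorem evenOddIter_mem (n : ℕ) :
    (evenOddIter n).1 ∈ nonnegPolynomials ∧ (evenOddIter n).2 ∈ nonnegPolynomials := by
  induction n with
  | zero => exact ⟨zero_mem _, zero_mem _⟩
  | succ n ih =>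
    have hc : ∀ r : ℝ, 0 ≤ r → (fun _ _ => r : ℝ → ℝ → ℝ) ∈ nonnegPolynomials := fun r hr => by
      simpa using monomial_mem_nonnegPolynomials hr 0 0
    have hp : (fun p _ => p ^ 2 : ℝ → ℝ → ℝ) ∈ nonnegPolynomials := by
      simpa using monomial_mem_nonnegPolynomials zero_le_one 2 0
    have hpq : (fun p q => p * q : ℝ → ℝ → ℝ) ∈ nonnegPolynomials := by
      simpa using monomial_mem_nonnegPolynomials zero_le_one 1 1
    obtain ⟨hu, hv⟩ := ih
    constructor
    · have := mul_mem (hc (1 / 2) (by norm_num)) (add_mem (add_mem (add_mem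
        (hc (3 / 10) (by norm_num)) (mul_mem (hc (4 / 10) (by norm_num)) hp)) (mul_mem hu hu))
        (mul_mem (mul_mem hv hv) (add_mem (add_mem (hc 1 (by norm_num))
          (mul_mem (hc 4 (by norm_num)) hp)) (mul_mem (hc 4 (by norm_num)) hpq))))
      convert this using 1
      ext p q
      simp [evenOddIter, innerSq]
      ring
    · have := mul_mem (hc (1 / 2) (by norm_num)) (add_mem (hc (1 / 10) (by norm_num))
        (mul_mem (mul_mem (hc 2 (by norm_num)) hu) hv))
      convert this using 1
      ext p q
      simp [evenOddIter]
      ring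

/-- Either root R is allowed; adding the identities for R and -R isolates the even part. -/
theorem evenOddIter_eq {p q R : ℝ} (hR : R ^ 2 = innerSq p q) (n : ℕ) :
    (evenOddIter n).1 p q + R * (evenOddIter n).2 p q = sqrtIter n ((3 + 4 * p ^ 2 + R) / 10) := by
  induction n with
  | zero => simp [evenOddIter, sqrtIter]
  | succ n ih =>
    simp only [sqrtIter, evenOddIter, ← ih, ← hR]
    ring

/-- Since |pq| ≤ |p|, the value lies between (1 - 2|p|)² and (1 + 2|p|)². -/
theorem innerSq_nonneg {p q : ℝ} (hq : |q| ≤ 1) :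
    0 ≤ innerSq p q ∧ √(innerSq p q) ≤ 1 + 2 * |p| := by
  have h : |p * q| ≤ |p| := by
    rw [abs_mul]; exact mul_le_of_le_one_right (abs_nonneg _) hq
  have h1 := abs_le.1 h
  have h2 := sq_abs p
  constructor
  · unfold innerSq; nlinarith [sq_nonneg (1 - 2 * |p|)]
  · rw [Real.sqrt_le_left (by positivity)]
    unfold innerSq; nlinarith

/-- Writing 7 - 4p² ∓ R = 10(1 - (3 + 4p² ± R)/10) puts both arguments of the iteration in [0, 1];
the odd parts cancel in the mean of the branches. -/
theorem siteDensity_approx {p q : ℝ} (hp : |p| ≤ 1) (hq : |q| ≤ 1) (n : ℕ) :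
    siteDensity p q ≤ √10 * (1 - (evenOddIter n).1 p q) ∧
      √10 * (1 - (evenOddIter n).1 p q) ≤ siteDensity p q + √10 * (2 / (n + 2)) := by
  obtain ⟨h0, h1⟩ := innerSq_nonneg (p := p) hq
  have hR := Real.sq_sqrt h0
  have hR0 := Real.sqrt_nonneg (innerSq p q)
  set R := √(innerSq p q) with hRdef
  have hp0 := abs_nonneg p
  have hpp := sq_abs p
  have e1 := evenOddIter_eq hR n
  have e2 := evenOddIter_eq (R := -R) (by rw [neg_sq, hR]) n
  obtain ⟨_, a2, a3⟩ := sqrtIter_bounds (x := (3 + 4 * p ^ 2 + R) / 10)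
    (by positivity) (by nlinarith) n
  obtain ⟨_, b2, b3⟩ := sqrtIter_bounds (x := (3 + 4 * p ^ 2 + -R) / 10)
    (by nlinarith [sq_nonneg (2 * |p| - 1)]) (by nlinarith) n
  have s1 : √(7 - 4 * p ^ 2 - R) = √10 * √(1 - (3 + 4 * p ^ 2 + R) / 10) := by
    rw [← Real.sqrt_mul (by norm_num)]; congr 1; ring
  have s2 : √(7 - 4 * p ^ 2 + R) = √10 * √(1 - (3 + 4 * p ^ 2 + -R) / 10) := by
    rw [← Real.sqrt_mul (by norm_num)]; congr 1; ring
  have h10 : (0 : ℝ) ≤ √10 := Real.sqrt_nonneg _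
  rw [siteDensity, ← hRdef, s1, s2, ← mul_add, mul_div_assoc, ← mul_add]
  constructor
  · exact mul_le_mul_of_nonneg_left (by linarith) h10
  · exact mul_le_mul_of_nonneg_left (by linarith) h10

theorem continuous_siteDensity : Continuous (Function.uncurry siteDensity) := by
  simp only [Function.uncurry_def, siteDensity, innerSq]
  fun_prop

/-- The density is a uniform limit of √10 (1 - u) with u a polynomial with nonnegative coefficients.
The minus sign reverses the inequality between the moments. -/
theorem doubleAverage_siteDensity_le {E₁ E₁' E₂ E₂' : (ℝ → ℝ) → ℝ}
    (h₁ : IsAverage E₁) (h₁' : IsAverage E₁') (h₂ : IsAverage E₂) (h₂' : IsAverage E₂')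
    (h0 : ∀ k : ℕ, 0 ≤ E₁ fun t => Real.cos t ^ k)
    (h0' : ∀ k : ℕ, 0 ≤ E₁' fun t => Real.cos t ^ k)
    (hle : ∀ k : ℕ, (E₁ fun t => Real.cos t ^ k) ≤ E₂ fun t => Real.cos t ^ k)
    (hle' : ∀ k : ℕ, (E₁' fun t => Real.cos t ^ k) ≤ E₂' fun t => Real.cos t ^ k) :
    doubleAverage E₂ E₂' siteDensity ≤ doubleAverage E₁ E₁' siteDensity := by
  have hlim : Tendsto (fun n : ℕ => doubleAverage E₁ E₁' siteDensity + √10 * (2 / ((n : ℝ) + 2)))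
      atTop (𝓝 (doubleAverage E₁ E₁' siteDensity + √10 * 0)) := by
    refine tendsto_const_nhds.add (tendsto_const_nhds.mul ?_)
    exact tendsto_const_nhds.div_atTop
      (tendsto_atTop_add_const_right _ _ tendsto_natCast_atTop_atTop)
  rw [mul_zero, add_zero] at hlim
  refine ge_of_tendsto' hlim fun n => ?_
  set u := (evenOddIter n).1 with hu
  obtain ⟨huc, hule⟩ := nonnegPolynomials_average_le h₁ h₁' h₂ h₂' h0 h0' hle hle'
    (evenOddIter_mem n).1
  have hform : ∀ {E E' : (ℝ → ℝ) → ℝ}, IsAverage E → IsAverage E' →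
      doubleAverage E E' (fun p q => √10 + -√10 * u p q) =
        √10 * (1 - doubleAverage E E' u) := by
    intro E E' hE hE'
    rw [doubleAverage_add hE hE' (f := fun _ _ => √10) (g := fun p q => -√10 * u p q)
      continuous_const (continuous_const.mul huc), doubleAverage_const hE hE',
      doubleAverage_const_mul hE hE' huc]
    ring
  have hc : Continuous (Function.uncurry fun p q => √10 + -√10 * u p q) :=
    continuous_const.add (continuous_const.mul huc)
  calc doubleAverage E₂ E₂' siteDensity
      ≤ doubleAverage E₂ E₂' (fun p q => √10 + -√10 * u p q) := by
        refine doubleAverage_mono h₂ h₂' continuous_siteDensity hc fun p q hp hq => ?_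
        have := (siteDensity_approx hp hq n).1
        linarith
    _ = √10 * (1 - doubleAverage E₂ E₂' u) := hform h₂ h₂'
    _ ≤ √10 * (1 - doubleAverage E₁ E₁' u) :=
        mul_le_mul_of_nonneg_left (by linarith) (Real.sqrt_nonneg _)
    _ = doubleAverage E₁ E₁' (fun p q => √10 + -√10 * u p q) := (hform h₁ h₁').symm
    _ ≤ doubleAverage E₁ E₁' (fun p q => siteDensity p q + √10 * (2 / ((n : ℝ) + 2))) := by
        refine doubleAverage_mono h₁ h₁' hc (continuous_siteDensity.add continuous_const)
          fun p q hp hq => ?_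
        have := (siteDensity_approx hp hq n).2
        linarith
    _ = doubleAverage E₁ E₁' siteDensity + √10 * (2 / ((n : ℝ) + 2)) := by
        rw [doubleAverage_add h₁ h₁' (g := fun _ _ => √10 * (2 / ((n : ℝ) + 2)))
          continuous_siteDensity continuous_const, doubleAverage_const h₁ h₁']

/-! ### The limit per vertex as a double average -/

/-- By sum-to-product, cos 2πy + cos 2π(x + y) = 2 cos(πx) cos(2πy + πx). -/
theorem innerRoot_eq (x y : ℝ) :
    innerRoot x y =
      √(innerSq (Real.cos (Real.pi * x)) (Real.cos (2 * Real.pi * y + Real.pi * x))) := by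
  rw [innerRoot, innerSq]
  congr 1
  have h1 : 2 * Real.pi * x = 2 * (Real.pi * x) := by ring
  have h2 : 2 * Real.pi * y = (2 * Real.pi * y + Real.pi * x) - Real.pi * x := by ring
  have h3 : 2 * Real.pi * (x + y) = (2 * Real.pi * y + Real.pi * x) + Real.pi * x := by ring
  rw [h1, h3]
  nth_rw 1 [h2]
  rw [Real.cos_two_mul, Real.cos_add (2 * Real.pi * y + Real.pi * x), Real.cos_sub]
  ring

/-- Periodicity removes the shift, and evenness of the cosine folds the full circle onto the half
circle. -/
theorem integral_cos_shift {f : ℝ → ℝ} (hf : Continuous f) (a : ℝ) :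
    ∫ y in (0 : ℝ)..1, f (Real.cos (2 * Real.pi * y + a)) =
      ∫ y in (0 : ℝ)..1, f (Real.cos (Real.pi * y)) := by
  have hpi := Real.pi_pos
  have hc : Continuous fun t => f (Real.cos t) := hf.comp Real.continuous_cos
  have hper : Function.Periodic (fun t => f (Real.cos t)) (2 * Real.pi) := fun t => by simp
  have e1 : ∫ y in (0 : ℝ)..1, f (Real.cos (2 * Real.pi * y + a)) =
      (2 * Real.pi)⁻¹ * ∫ t in (-Real.pi)..Real.pi, f (Real.cos t) := by
    rw [intervalIntegral.integral_comp_mul_add (fun t => f (Real.cos t)) (by positivity) a,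
      smul_eq_mul]
    congr 1
    have := hper.intervalIntegral_add_eq a (-Real.pi)
    rw [show -Real.pi + 2 * Real.pi = Real.pi by ring] at this
    rw [← this]
    congr 1 <;> ring
  have e2 : ∫ y in (0 : ℝ)..1, f (Real.cos (Real.pi * y)) =
      Real.pi⁻¹ * ∫ t in (0 : ℝ)..Real.pi, f (Real.cos t) := by
    rw [intervalIntegral.integral_comp_mul_left (fun t => f (Real.cos t)) hpi.ne', smul_eq_mul]
    simp
  have e3 : ∫ t in (-Real.pi)..0, f (Real.cos t) = ∫ t in (0 : ℝ)..Real.pi, f (Real.cos t) := by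
    have := intervalIntegral.integral_comp_neg (a := 0) (b := Real.pi) (fun t => f (Real.cos t))
    simp only [Real.cos_neg, neg_zero] at this
    exact this.symm
  rw [e1, e2, ← intervalIntegral.integral_add_adjacent_intervals (b := 0)
    (hc.intervalIntegrable _ _) (hc.intervalIntegrable _ _), e3]
  field_simp
  ring

theorem limitPerVertex_eq : limitPerVertex = doubleAverage avgInt avgInt siteDensity := by
  set A : ℝ → ℝ → ℝ := fun p q => √(7 - 4 * p ^ 2 - √(innerSq p q)) with hA
  set B : ℝ → ℝ → ℝ := fun p q => √(7 - 4 * p ^ 2 + √(innerSq p q)) with hB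
  have hAc : Continuous (Function.uncurry A) := by
    simp only [hA, Function.uncurry_def, innerSq]; fun_prop
  have hBc : Continuous (Function.uncurry B) := by
    simp only [hB, Function.uncurry_def, innerSq]; fun_prop
  have h := isAverage_avgInt
  have h7 : ∀ x : ℝ, 5 - 2 * Real.cos (2 * Real.pi * x) = 7 - 4 * Real.cos (Real.pi * x) ^ 2 := by
    intro x
    rw [show 2 * Real.pi * x = 2 * (Real.pi * x) by ring, Real.cos_two_mul]; ring
  have e1 : ∫ x in (0 : ℝ)..1, ∫ y in (0 : ℝ)..1,
      √(5 - 2 * Real.cos (2 * Real.pi * x) - innerRoot x y) = doubleAverage avgInt avgInt A := by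
    refine intervalIntegral.integral_congr fun x _ => ?_
    have := integral_cos_shift (f := A (Real.cos (Real.pi * x)))
      (hAc.comp (continuous_const.prodMk continuous_id)) (Real.pi * x)
    simp only [innerRoot_eq, h7]
    exact this
  have e2 : ∫ x in (0 : ℝ)..1, ∫ y in (0 : ℝ)..1,
      √(5 - 2 * Real.cos (2 * Real.pi * x) + innerRoot x y) = doubleAverage avgInt avgInt B := by
    refine intervalIntegral.integral_congr fun x _ => ?_
    have := integral_cos_shift (f := B (Real.cos (Real.pi * x)))
      (hBc.comp (continuous_const.prodMk continuous_id)) (Real.pi * x)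
    simp only [innerRoot_eq, h7]
    exact this
  rw [limitPerVertex, e1, e2, ← doubleAverage_const_mul h h hAc, ← doubleAverage_const_mul h h hBc,
    ← doubleAverage_add h h (f := fun p q => 1 / 2 * A p q) (g := fun p q => 1 / 2 * B p q)
      (continuous_const.mul hAc : Continuous fun z : ℝ × ℝ => 1 / 2 * Function.uncurry A z)
      (continuous_const.mul hBc : Continuous fun z : ℝ × ℝ => 1 / 2 * Function.uncurry B z)]
  congr 1
  ext p q
  simp only [hA, hB, siteDensity]
  ring

theorem limitPerVertex_le_avgMid {M K : ℕ} (hM : 0 < M) (hK : 0 < K) :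
    limitPerVertex ≤ doubleAverage (avgMid M) (avgMid K) siteDensity := by
  rw [limitPerVertex_eq]
  exact doubleAverage_siteDensity_le (isAverage_avgMid hM) (isAverage_avgMid hK)
    isAverage_avgInt isAverage_avgInt (avgMid_cos_pow_nonneg hM) (avgMid_cos_pow_nonneg hK)
    (avgMid_cos_pow_le_avgInt hM) (avgMid_cos_pow_le_avgInt hK)

theorem avgTrap_le_limitPerVertex {M K : ℕ} (hM : 0 < M) (hK : 0 < K) :
    doubleAverage (avgTrap M) (avgTrap K) siteDensity ≤ limitPerVertex := by
  rw [limitPerVertex_eq]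
  have h0 : ∀ k : ℕ, 0 ≤ avgInt fun t => Real.cos t ^ k := fun k => by
    simpa using avgInt_cos_pow_nonneg k 0
  exact doubleAverage_siteDensity_le isAverage_avgInt isAverage_avgInt (isAverage_avgTrap hM)
    (isAverage_avgTrap hK) h0 h0 (avgInt_cos_pow_le_avgTrap hM) (avgInt_cos_pow_le_avgTrap hK)

/-! ### Integer arithmetic for the numerical value -/

/-- Evaluates the argument before it is passed on. -/
def forceNat {β : Type} (n : ℕ) (f : ℕ → β) : β :=
  match n with
  | 0 => f 0
  | k + 1 => f (k + 1)

theorem forceNat_eq {β : Type} (n : ℕ) (f : ℕ → β) : forceNat n f = f n := by cases n <;> rfl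

/-- Evaluates the argument before it is passed on. -/
def forceInt {β : Type} (z : ℤ) (f : ℤ → β) : β :=
  match z with
  | Int.ofNat n => forceNat n fun k => f (Int.ofNat k)
  | Int.negSucc n => forceNat n fun k => f (Int.negSucc k)

theorem forceInt_eq {β : Type} (z : ℤ) (f : ℤ → β) : forceInt z f = f z := by
  cases z <;> simp [forceInt, forceNat_eq]

/-- The sum of the first values of a function. -/
def sumBelow (f : ℕ → ℕ) : ℕ → ℕ
  | 0 => 0
  | n + 1 => forceNat (sumBelow f n) fun s => s + f n

theorem sumBelow_eq (f : ℕ → ℕ) (n : ℕ) : sumBelow f n = ∑ i ∈ Finset.range n, f i := by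
  induction n with
  | zero => rfl
  | succ n ih => rw [sumBelow, forceNat_eq, Finset.sum_range_succ, ih]

/-- Newton's iteration for the integer square root of `n`. -/
def newtonSqrt (n : ℕ) : ℕ → ℕ → ℕ
  | 0, x => x
  | k + 1, x => forceNat ((x + n / x) / 2) fun y => newtonSqrt n k y

/-- A lower bound for `√n`, found by Newton's iteration from `x`. -/
def sqrtFloor (x n : ℕ) : ℕ :=
  forceNat n fun n => forceNat (newtonSqrt n 16 x) fun w => if w * w ≤ n then w else 0

/-- An upper bound for `√n`, found by Newton's iteration from `x`. -/
def sqrtCeil (x n : ℕ) : ℕ :=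
  forceNat n fun n => forceNat (newtonSqrt n 16 x + 1) fun w => if n ≤ w * w then w else n

/-- The Newton value is tested before it is used and replaced by a trivial bound if the test fails,
so no convergence statement is needed. -/
theorem sqrtFloor_spec (x n : ℕ) : sqrtFloor x n * sqrtFloor x n ≤ n := by
  rw [sqrtFloor, forceNat_eq, forceNat_eq]
  split_ifs with h
  · exact h
  · simp

theorem le_sqrtCeil (x n : ℕ) : n ≤ sqrtCeil x n * sqrtCeil x n := by
  rw [sqrtCeil, forceNat_eq, forceNat_eq]
  split_ifs with h
  · exact h
  · exact Nat.le_mul_self n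

/-- `10¹⁰ cos (kπ / 64)`, up to an error of at most `2`, from the Taylor polynomial. -/
def cosScaled (k : ℕ) : ℤ :=
  (10 ^ 10 * (Int.ofNat (sumBelow (fun m => (k * 3141592653589793) ^ (4 * m) *
      (64 * 10 ^ 15) ^ (24 - 4 * m) * (Nat.factorial 24 / Nat.factorial (4 * m))) 7) -
    Int.ofNat (sumBelow (fun m => (k * 3141592653589793) ^ (4 * m + 2) *
      (64 * 10 ^ 15) ^ (22 - 4 * m) * (Nat.factorial 24 / Nat.factorial (4 * m + 2))) 6))) /
  Int.ofNat ((64 * 10 ^ 15) ^ 24 * Nat.factorial 24)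

/-- A lower bound for `10¹⁰` times the site density at `(P, Q) / 10¹⁰`, robust against errors of
at most `2` in `P` and `Q`. -/
def densityFloor (P Q : ℤ) : ℕ :=
  forceNat (sqrtFloor (7 * 10 ^ 20) (48 * 10 ^ 40 - 60 * (P * P) * 10 ^ 20 +
      16 * (P * P) * (P * P) - 4 * (P * Q) * 10 ^ 20 - 400 * 10 ^ 30).toNat) fun w =>
    sqrtFloor (2 * 10 ^ 10) ((7 * 10 ^ 20 - 4 * (P * P) - 17 * 10 ^ 10 + w) / 2).toNat

/-- An upper bound for `10¹⁰` times the site density at `(P, Q) / 10¹⁰`, robust against errors of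
at most `2` in `P` and `Q`. -/
def densityCeil (P Q : ℤ) : ℕ :=
  forceNat (sqrtCeil (7 * 10 ^ 20) (48 * 10 ^ 40 - 60 * (P * P) * 10 ^ 20 +
      16 * (P * P) * (P * P) - 4 * (P * Q) * 10 ^ 20 + 400 * 10 ^ 30).toNat) fun w =>
    sqrtCeil (2 * 10 ^ 10) ((7 * 10 ^ 20 - 4 * (P * P) + 17 * 10 ^ 10 + w) / 2 + 1).toNat

/-- The weights of the trapezoidal rule, doubled. -/
def trapWeight (M j : ℕ) : ℕ := if j = 0 ∨ j = M then 1 else 2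

/-- An upper bound for `10¹⁰ · 32 · 8` times the value of the midpoint rule. -/
def midpointSum : ℕ :=
  sumBelow (fun i => forceInt (cosScaled (2 * i + 1)) fun P =>
    sumBelow (fun j => forceInt (cosScaled (4 * (2 * j + 1))) fun Q => densityCeil P Q) 8) 32

/-- A lower bound for `10¹⁰ · 64 · 16` times the value of the trapezoidal rule. -/
def trapezoidSum : ℕ :=
  sumBelow (fun i => trapWeight 32 i * forceInt (cosScaled (2 * i)) fun P =>
    sumBelow (fun j => trapWeight 8 j * forceInt (cosScaled (8 * j)) fun Q =>
      densityFloor P Q) 9) 33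

/-- With the trapezoidal counterpart this confines the limit to [2.15246, 2.152545]. -/
theorem midpointSum_lt : midpointSum ≤ 21525450000 * 256 := by decide +kernel

theorem lt_trapezoidSum : 21524600000 * 1024 ≤ trapezoidSum := by decide +kernel

/-- Squaring the sum of the branches leaves R only through R², so two nested square roots, the inner
one of a polynomial, suffice for the evaluation. -/
theorem siteDensity_eq_sqrt {p q : ℝ} (hp : |p| ≤ 1) (hq : |q| ≤ 1) :
    siteDensity p q = √((7 - 4 * p ^ 2 + √((7 - 4 * p ^ 2) ^ 2 - innerSq p q)) / 2) := by
  obtain ⟨h0, h1⟩ := innerSq_nonneg (p := p) hq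
  have hR := Real.sq_sqrt h0
  have hR0 := Real.sqrt_nonneg (innerSq p q)
  set R := √(innerSq p q)
  have hp0 := abs_nonneg p
  have hpp := sq_abs p
  have ha : R ≤ 7 - 4 * p ^ 2 := by nlinarith
  have e : √((7 - 4 * p ^ 2) ^ 2 - innerSq p q) =
      √(7 - 4 * p ^ 2 - R) * √(7 - 4 * p ^ 2 + R) := by
    rw [← Real.sqrt_mul (by linarith), ← hR]; congr 1; ring
  have s1 := Real.sq_sqrt (show 0 ≤ 7 - 4 * p ^ 2 - R by linarith)
  have s2 := Real.sq_sqrt (show 0 ≤ 7 - 4 * p ^ 2 + R by linarith)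
  symm
  rw [Real.sqrt_eq_iff_mul_self_eq (div_nonneg (add_nonneg (by linarith) (Real.sqrt_nonneg _)) zero_le_two) (by unfold siteDensity; positivity), e, siteDensity]
  nlinarith

/-- The squares and the product move by at most 4·10¹⁰ + 4 and the fourth power by 85·10²⁹. With the
coefficients 60, 16 and 4 this makes about 240 + 136 + 16 < 400 units of 10³⁰, and 4(4·10¹⁰ + 4) <
17·10¹⁰. -/
theorem scaled_error {p q : ℝ} {P Q : ℤ} (hp : |p| ≤ 1) (hq : |q| ≤ 1)
    (hP : |10 ^ 10 * p - P| ≤ 2) (hQ : |10 ^ 10 * q - Q| ≤ 2) :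
    |10 ^ 20 * (7 - 4 * p ^ 2) - (7 * 10 ^ 20 - 4 * ((P : ℝ) * P))| ≤ 17 * 10 ^ 10 ∧
    |10 ^ 40 * ((7 - 4 * p ^ 2) ^ 2 - innerSq p q) - (48 * 10 ^ 40 - 60 * ((P : ℝ) * P) * 10 ^ 20 +
      16 * ((P : ℝ) * P) * (P * P) - 4 * ((P : ℝ) * Q) * 10 ^ 20)| ≤ 400 * 10 ^ 30 := by
  obtain ⟨x, hx⟩ : ∃ x, x = 10 ^ 10 * p := ⟨_, rfl⟩
  obtain ⟨y, hy⟩ : ∃ y, y = 10 ^ 10 * q := ⟨_, rfl⟩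
  have hxa : |x| ≤ 10 ^ 10 := by
    rw [hx, abs_mul, abs_of_pos (by norm_num : (0 : ℝ) < 10 ^ 10)]; linarith
  have hya : |y| ≤ 10 ^ 10 := by
    rw [hy, abs_mul, abs_of_pos (by norm_num : (0 : ℝ) < 10 ^ 10)]; linarith
  rw [← hx] at hP
  rw [← hy] at hQ
  have hQa : |(Q : ℝ)| ≤ 10 ^ 10 + 2 := by
    have := abs_sub_abs_le_abs_sub (Q : ℝ) y
    rw [abs_sub_comm] at this; linarith
  have hPa : |(P : ℝ)| ≤ 10 ^ 10 + 2 := by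
    have := abs_sub_abs_le_abs_sub (P : ℝ) x
    rw [abs_sub_comm] at this; linarith
  have h1 : |x ^ 2 - P * P| ≤ 4 * 10 ^ 10 + 4 := by
    rw [show x ^ 2 - (P : ℝ) * P = (x - P) * (x + P) by ring, abs_mul]
    calc |x - P| * |x + P| ≤ 2 * (10 ^ 10 + (10 ^ 10 + 2)) :=
          mul_le_mul hP ((abs_add_le _ _).trans (add_le_add hxa hPa)) (abs_nonneg _) zero_le_two
      _ = 4 * 10 ^ 10 + 4 := by norm_num
  have h2 : |x ^ 2 * x ^ 2 - P * P * (P * P)| ≤ 85 * 10 ^ 29 := by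
    rw [show x ^ 2 * x ^ 2 - (P : ℝ) * P * (P * P) = (x ^ 2 - P * P) * (x ^ 2 + P * P) by ring,
      abs_mul]
    have e1 : |x ^ 2| ≤ (10 ^ 10) ^ 2 := by
      rw [abs_pow]; exact pow_le_pow_left₀ (abs_nonneg _) hxa 2
    have e2 : |(P : ℝ) * P| ≤ (10 ^ 10 + 2) * (10 ^ 10 + 2) := by
      rw [abs_mul]; exact mul_le_mul hPa hPa (abs_nonneg _) (by norm_num)
    calc |x ^ 2 - P * P| * |x ^ 2 + P * P|
        ≤ (4 * 10 ^ 10 + 4) * ((10 ^ 10) ^ 2 + (10 ^ 10 + 2) * (10 ^ 10 + 2)) :=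
          mul_le_mul h1 ((abs_add_le _ _).trans (add_le_add e1 e2)) (abs_nonneg _) (by norm_num)
      _ ≤ _ := by norm_num
  have h3 : |x * y - P * Q| ≤ 4 * 10 ^ 10 + 4 := by
    rw [show x * y - (P : ℝ) * Q = x * (y - Q) + (x - P) * Q by ring]
    refine (abs_add_le _ _).trans ?_
    rw [abs_mul, abs_mul]
    calc |x| * |y - Q| + |x - P| * |(Q : ℝ)| ≤ 10 ^ 10 * 2 + 2 * (10 ^ 10 + 2) :=
          add_le_add (mul_le_mul hxa hQ (abs_nonneg _) (by norm_num))
            (mul_le_mul hP hQa (abs_nonneg _) (by norm_num))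
      _ = _ := by norm_num
  have hpx : p = x / 10 ^ 10 := by rw [hx]; field_simp
  have hqy : q = y / 10 ^ 10 := by rw [hy]; field_simp
  rw [abs_le] at h1 h2 h3
  constructor
  · rw [show 10 ^ 20 * (7 - 4 * p ^ 2) - (7 * 10 ^ 20 - 4 * ((P : ℝ) * P)) =
      -4 * (x ^ 2 - P * P) by rw [hpx]; ring, abs_le]
    constructor <;> linarith
  · rw [show 10 ^ 40 * ((7 - 4 * p ^ 2) ^ 2 - innerSq p q) -
        (48 * 10 ^ 40 - 60 * ((P : ℝ) * P) * 10 ^ 20 +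
        16 * ((P : ℝ) * P) * (P * P) - 4 * ((P : ℝ) * Q) * 10 ^ 20) =
      -60 * 10 ^ 20 * (x ^ 2 - P * P) + 16 * (x ^ 2 * x ^ 2 - P * P * (P * P)) -
        4 * 10 ^ 20 * (x * y - P * Q) by rw [hpx, hqy, innerSq]; ring, abs_le]
    constructor <;> linarith

theorem densityFloor_le {p q : ℝ} {P Q : ℤ} (hp : |p| ≤ 1) (hq : |q| ≤ 1)
    (hP : |10 ^ 10 * p - P| ≤ 2) (hQ : |10 ^ 10 * q - Q| ≤ 2) :
    (densityFloor P Q : ℝ) ≤ 10 ^ 10 * siteDensity p q := by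
  obtain ⟨ha, hu⟩ := scaled_error hp hq hP hQ
  rw [siteDensity_eq_sqrt hp hq, densityFloor, forceNat_eq]
  set a := 7 - 4 * p ^ 2
  set u := a ^ 2 - innerSq p q
  set U : ℤ := 48 * 10 ^ 40 - 60 * (P * P) * 10 ^ 20 +
      16 * (P * P) * (P * P) - 4 * (P * Q) * 10 ^ 20 - 400 * 10 ^ 30 with hU
  have hUR : (U : ℝ) = 48 * 10 ^ 40 - 60 * ((P : ℝ) * P) * 10 ^ 20 +
      16 * ((P : ℝ) * P) * (P * P) - 4 * ((P : ℝ) * Q) * 10 ^ 20 - 400 * 10 ^ 30 := by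
    rw [hU]; push_cast; ring
  set w := sqrtFloor (7 * 10 ^ 20) U.toNat with hw
  have hw2 : (w : ℝ) ≤ 10 ^ 20 * √u := by
    have h := sqrtFloor_spec (7 * 10 ^ 20) U.toNat
    rw [← hw] at h
    -- A nonpositive `U` is truncated to 0, and the resulting lower bound 0 is harmless.
    rcases le_or_gt U 0 with hU0 | hU0
    · rw [Int.toNat_of_nonpos hU0] at h
      have : w = 0 := by nlinarith
      rw [this, Nat.cast_zero]; positivity
    · have h' : ((w * w : ℕ) : ℤ) ≤ U := by
        have : ((U.toNat : ℕ) : ℤ) = U := Int.toNat_of_nonneg hU0.le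
        omega
      have h'' : (w : ℝ) * w ≤ U := by exact_mod_cast h'
      have hU1 : (U : ℝ) ≤ 10 ^ 40 * u := by rw [abs_le] at hu; linarith
      rw [show (10 : ℝ) ^ 20 * √u = √(10 ^ 40 * u) by
        rw [Real.sqrt_mul (by norm_num), show (10 : ℝ) ^ 40 = (10 ^ 20) ^ 2 by norm_num,
          Real.sqrt_sq (by norm_num)]]
      apply Real.le_sqrt_of_sq_le
      rw [sq]; linarith
  set V : ℤ := (7 * 10 ^ 20 - 4 * (P * P) - 17 * 10 ^ 10 + w) / 2 with hV
  set s := sqrtFloor (2 * 10 ^ 10) V.toNat with hs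
  have h := sqrtFloor_spec (2 * 10 ^ 10) V.toNat
  rw [← hs] at h
  rcases le_or_gt V 0 with hV0 | hV0
  · rw [Int.toNat_of_nonpos hV0] at h
    have : s = 0 := by nlinarith
    rw [this, Nat.cast_zero]; positivity
  · have h' : ((s * s : ℕ) : ℤ) * 2 ≤ 7 * 10 ^ 20 - 4 * (P * P) - 17 * 10 ^ 10 + w := by
      have : ((V.toNat : ℕ) : ℤ) = V := Int.toNat_of_nonneg hV0.le
      have h2 : ((s * s : ℕ) : ℤ) ≤ V := by omega
      omega
    have h'' : (s : ℝ) * s * 2 ≤ 7 * 10 ^ 20 - 4 * ((P : ℝ) * P) - 17 * 10 ^ 10 + w := by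
      exact_mod_cast h'
    rw [show (10 : ℝ) ^ 10 * √((a + √u) / 2) = √(10 ^ 20 * ((a + √u) / 2)) by
      rw [Real.sqrt_mul (by norm_num), show (10 : ℝ) ^ 20 = (10 ^ 10) ^ 2 by norm_num,
        Real.sqrt_sq (by norm_num)]]
    apply Real.le_sqrt_of_sq_le
    rw [abs_le] at ha
    rw [sq]; linarith

theorem le_densityCeil {p q : ℝ} {P Q : ℤ} (hp : |p| ≤ 1) (hq : |q| ≤ 1)
    (hP : |10 ^ 10 * p - P| ≤ 2) (hQ : |10 ^ 10 * q - Q| ≤ 2) :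
    10 ^ 10 * siteDensity p q ≤ densityCeil P Q := by
  obtain ⟨ha, hu⟩ := scaled_error hp hq hP hQ
  rw [siteDensity_eq_sqrt hp hq, densityCeil, forceNat_eq]
  set a := 7 - 4 * p ^ 2
  set u := a ^ 2 - innerSq p q
  set U : ℤ := 48 * 10 ^ 40 - 60 * (P * P) * 10 ^ 20 +
      16 * (P * P) * (P * P) - 4 * (P * Q) * 10 ^ 20 + 400 * 10 ^ 30 with hU
  have hUR : (U : ℝ) = 48 * 10 ^ 40 - 60 * ((P : ℝ) * P) * 10 ^ 20 +
      16 * ((P : ℝ) * P) * (P * P) - 4 * ((P : ℝ) * Q) * 10 ^ 20 + 400 * 10 ^ 30 := by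
    rw [hU]; push_cast; ring
  set w := sqrtCeil (7 * 10 ^ 20) U.toNat with hw
  have hw2 : 10 ^ 20 * √u ≤ w := by
    have h := le_sqrtCeil (7 * 10 ^ 20) U.toNat
    rw [← hw] at h
    have h' : U ≤ ((w * w : ℕ) : ℤ) := by omega
    have h'' : (U : ℝ) ≤ (w : ℝ) * w := by exact_mod_cast h'
    have hU1 : 10 ^ 40 * u ≤ U := by rw [abs_le] at hu; linarith
    rw [show (10 : ℝ) ^ 20 * √u = √(10 ^ 40 * u) by
      rw [Real.sqrt_mul (by norm_num), show (10 : ℝ) ^ 40 = (10 ^ 20) ^ 2 by norm_num,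
        Real.sqrt_sq (by norm_num)]]
    apply Real.sqrt_le_iff.2 ⟨by positivity, ?_⟩
    rw [sq]; linarith
  -- The summand 1 makes up for the downward rounding of the integer division.
  set V : ℤ := (7 * 10 ^ 20 - 4 * (P * P) + 17 * 10 ^ 10 + w) / 2 + 1 with hV
  set s := sqrtCeil (2 * 10 ^ 10) V.toNat with hs
  have h := le_sqrtCeil (2 * 10 ^ 10) V.toNat
  rw [← hs] at h
  have h' : 7 * 10 ^ 20 - 4 * (P * P) + 17 * 10 ^ 10 + w ≤ ((s * s : ℕ) : ℤ) * 2 := by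
    have h2 : V ≤ ((s * s : ℕ) : ℤ) := by omega
    omega
  have h'' : 7 * 10 ^ 20 - 4 * ((P : ℝ) * P) + 17 * 10 ^ 10 + w ≤ (s : ℝ) * s * 2 := by
    exact_mod_cast h'
  rw [show (10 : ℝ) ^ 10 * √((a + √u) / 2) = √(10 ^ 20 * ((a + √u) / 2)) by
    rw [Real.sqrt_mul (by norm_num), show (10 : ℝ) ^ 20 = (10 ^ 10) ^ 2 by norm_num,
      Real.sqrt_sq (by norm_num)]]
  apply Real.sqrt_le_iff.2 ⟨by positivity, ?_⟩
  rw [abs_le] at ha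
  rw [sq]; linarith

/-! ### The cosines at the nodes -/

/-- This is the real part of the exponential series at ix, cut after 26 terms; the remainder is at
most 2 · 3.15²⁶/26!. The radius 3.15 leaves room above π. -/
theorem cos_taylor_bound {x : ℝ} (hx : |x| ≤ 3.15) :
    |Real.cos x - ∑ m ∈ Finset.range 13, (-1) ^ m * x ^ (2 * m) / (Nat.factorial (2 * m) : ℝ)|
      ≤ 1 / 10 ^ 12 := by
  have hnorm : ‖(x * Complex.I : ℂ)‖ = |x| := by simp
  have h := Complex.exp_bound' (x := x * Complex.I) (n := 26) (by
    rw [hnorm, div_le_iff₀ (by positivity)]; push_cast; linarith)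
  rw [hnorm] at h
  have hre := (Complex.abs_re_le_norm _).trans h
  have hsum : (∑ m ∈ Finset.range 26, (x * Complex.I : ℂ) ^ m / (Nat.factorial m : ℂ)).re =
      ∑ m ∈ Finset.range 13, (-1) ^ m * x ^ (2 * m) / (Nat.factorial (2 * m) : ℝ) := by
    have key : ∀ n : ℕ, (∑ m ∈ Finset.range (2 * n),
        (x * Complex.I : ℂ) ^ m / (Nat.factorial m : ℂ)).re =
        ∑ m ∈ Finset.range n, (-1) ^ m * x ^ (2 * m) / (Nat.factorial (2 * m) : ℝ) := by
      intro n
      induction n with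
      | zero => simp
      | succ n ih =>
        rw [show 2 * (n + 1) = 2 * n + 1 + 1 by ring, Finset.sum_range_succ, Finset.sum_range_succ,
          Finset.sum_range_succ, Complex.add_re, Complex.add_re, ih]
        have e1 : (x * Complex.I : ℂ) ^ (2 * n) = (((-1) ^ n * x ^ (2 * n) : ℝ) : ℂ) := by
          rw [mul_pow, pow_mul Complex.I, Complex.I_sq]; push_cast; ring
        have e2 : (x * Complex.I : ℂ) ^ (2 * n) / (Nat.factorial (2 * n) : ℂ) =
            (((-1) ^ n * x ^ (2 * n) / (Nat.factorial (2 * n) : ℝ) : ℝ) : ℂ) := by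
          rw [e1]; push_cast; ring
        have e3 : (x * Complex.I : ℂ) ^ (2 * n + 1) / (Nat.factorial (2 * n + 1) : ℂ) =
            (((-1) ^ n * x ^ (2 * n) * x / (Nat.factorial (2 * n + 1) : ℝ) : ℝ) : ℂ) *
              Complex.I := by
          rw [pow_succ, e1]; push_cast; ring
        rw [e2, e3, Complex.ofReal_re, Complex.re_ofReal_mul, Complex.I_re]
        ring
    exact key 13
  rw [Complex.sub_re, Complex.exp_ofReal_mul_I_re, hsum] at hre
  refine hre.trans ?_
  calc |x| ^ 26 / (Nat.factorial 26 : ℝ) * 2 ≤ 3.15 ^ 26 / (Nat.factorial 26 : ℝ) * 2 := by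
        gcongr
    _ ≤ 1 / 10 ^ 12 := by norm_num [Nat.factorial]

/-- After scaling, the decimal approximation of π costs at most 10⁻⁴, the Taylor remainder at most
10⁻², and the final rounding at most 1. -/
theorem cosScaled_spec {k : ℕ} (hk : k ≤ 64) :
    |10 ^ 10 * Real.cos (k * (Real.pi / 64)) - cosScaled k| ≤ 2 := by
  set y : ℝ := k * 3141592653589793 / (64 * 10 ^ 15) with hy
  have hk' : (k : ℝ) ≤ 64 := by exact_mod_cast hk
  have hk0 : (0 : ℝ) ≤ k := by positivity
  have hp1 := Real.pi_gt_d20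
  have hp2 := Real.pi_lt_d20
  have hclose : |k * (Real.pi / 64) - y| ≤ 1 / 10 ^ 14 := by
    rw [hy, show k * (Real.pi / 64) - k * 3141592653589793 / (64 * 10 ^ 15) =
      k / 64 * (Real.pi - 3.141592653589793) by ring, abs_mul, abs_of_nonneg (by positivity),
      abs_of_nonneg (by linarith)]
    have h1 : (k : ℝ) / 64 ≤ 1 := by rw [div_le_one (by norm_num)]; exact hk'
    calc (k : ℝ) / 64 * (Real.pi - 3.141592653589793) ≤ 1 * (1 / 10 ^ 14) :=
          mul_le_mul h1 (by linarith) (by linarith) zero_le_one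
      _ = _ := one_mul _
  have hcos : |Real.cos (k * (Real.pi / 64)) - Real.cos y| ≤ 1 / 10 ^ 14 :=
    (Real.abs_cos_sub_cos_le _ _).trans hclose
  have hy0 : 0 ≤ y := by positivity
  have hy1 : |y| ≤ 3.15 := by
    rw [abs_of_nonneg hy0, hy, div_le_iff₀ (by norm_num)]; linarith
  have ht := cos_taylor_bound hy1
  set T := ∑ m ∈ Finset.range 13, (-1) ^ m * y ^ (2 * m) / (Nat.factorial (2 * m) : ℝ) with hT
  have hfloor : |10 ^ 10 * T - cosScaled k| ≤ 1 := by
    set num : ℤ := 10 ^ 10 * (Int.ofNat (sumBelow (fun m => (k * 3141592653589793) ^ (4 * m) *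
      (64 * 10 ^ 15) ^ (24 - 4 * m) * (Nat.factorial 24 / Nat.factorial (4 * m))) 7) -
      Int.ofNat (sumBelow (fun m => (k * 3141592653589793) ^ (4 * m + 2) *
      (64 * 10 ^ 15) ^ (22 - 4 * m) * (Nat.factorial 24 / Nat.factorial (4 * m + 2))) 6))
      with hnum
    set den : ℕ := (64 * 10 ^ 15) ^ 24 * Nat.factorial 24 with hden
    have hdef : cosScaled k = num / (den : ℤ) := rfl
    have hden0 : (0 : ℝ) < den := by
      have : 0 < den := by rw [hden]; positivity
      exact_mod_cast this
    -- Over the common denominator (64·10¹⁵)²⁴ · 24! the Taylor sum is an exact fraction, so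
    -- rounding happens only once.
    have hnumR : (num : ℝ) = 10 ^ 10 * T * den := by
      rw [hnum, hT, hden, hy]
      simp only [sumBelow_eq, Finset.sum_range_succ, Finset.sum_range_zero, Int.ofNat_eq_natCast]
      norm_num [Nat.factorial]
      ring
    have hdenZ : (0 : ℤ) < den := by exact_mod_cast hden0
    have h1 : (cosScaled k : ℝ) * den ≤ num := by
      rw [hdef]; exact_mod_cast Int.ediv_mul_le num hdenZ.ne'
    have h2 : (num : ℝ) < (cosScaled k + 1) * den := by
      rw [hdef]; exact_mod_cast Int.lt_ediv_add_one_mul_self num hdenZ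
    rw [hnumR] at h1 h2
    have h3 := le_of_mul_le_mul_right h1 hden0
    have h4 := lt_of_mul_lt_mul_right h2 hden0.le
    rw [abs_le]; constructor <;> linarith
  rw [abs_le] at *
  constructor <;> linarith [hcos.1, hcos.2, ht.1, ht.2, hfloor.1, hfloor.2]

/-! ### The numerical value of the limit -/

theorem limitPerVertex_le : limitPerVertex ≤ 2.1525450 := by
  refine (limitPerVertex_le_avgMid (M := 32) (K := 8) (by norm_num) (by norm_num)).trans ?_
  -- Both sets of nodes are expressed in multiples of π/64, as (2j + 1)π/16 = 4(2j + 1)π/64.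
  have hsum : (10 : ℝ) ^ 10 * (∑ i ∈ Finset.range 32, ∑ j ∈ Finset.range 8,
      siteDensity (Real.cos ((2 * i + 1 : ℕ) * (Real.pi / 64)))
        (Real.cos ((4 * (2 * j + 1) : ℕ) * (Real.pi / 64)))) ≤ midpointSum := by
    simp only [midpointSum, forceInt_eq, sumBelow_eq, Nat.cast_sum, Finset.mul_sum]
    refine Finset.sum_le_sum fun i hi => Finset.sum_le_sum fun j hj => ?_
    rw [Finset.mem_range] at hi hj
    exact le_densityCeil (Real.abs_cos_le_one _) (Real.abs_cos_le_one _)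
      (cosScaled_spec (by omega)) (cosScaled_spec (by omega))
  have hle : (midpointSum : ℝ) ≤ 21525450000 * 256 := by exact_mod_cast midpointSum_lt
  have heq : doubleAverage (avgMid 32) (avgMid 8) siteDensity =
      (∑ i ∈ Finset.range 32, ∑ j ∈ Finset.range 8,
      siteDensity (Real.cos ((2 * i + 1 : ℕ) * (Real.pi / 64)))
        (Real.cos ((4 * (2 * j + 1) : ℕ) * (Real.pi / 64)))) / 256 := by
    simp only [doubleAverage, avgMid, ← Finset.sum_div, div_div]
    congr 1
    · refine Finset.sum_congr rfl fun i _ => Finset.sum_congr rfl fun j _ => ?_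
      congr 2
      · push_cast; ring
      · push_cast; ring
    · norm_num
  rw [heq]
  linarith

theorem sum_add_sum_succ_eq_trapWeight {M : ℕ} (hM : 0 < M) (g : ℕ → ℝ) :
    ∑ j ∈ Finset.range M, (g j + g (j + 1)) =
      ∑ j ∈ Finset.range (M + 1), (trapWeight M j : ℝ) * g j := by
  have hw : ∀ j, (trapWeight M j : ℝ) * g j =
      2 * g j - (if j = 0 then g j else 0) - if j = M then g j else 0 := by
    intro j
    unfold trapWeight
    by_cases h0 : j = 0
    · have : ¬ j = M := by omega
      simp [h0, hM.ne]; ring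
    · by_cases h1 : j = M
      · simp [h1, hM.ne']; ring
      · simp [h0, h1]
  simp only [hw, Finset.sum_sub_distrib, Finset.sum_ite_eq', Finset.sum_add_distrib,
    ← Finset.mul_sum, Finset.mem_range]
  have h1 := Finset.sum_range_succ g M
  have h2 := Finset.sum_range_succ' g M
  simp only [Nat.zero_lt_succ, Nat.lt_succ_self, if_true]
  linarith

theorem le_limitPerVertex : 2.1524600 ≤ limitPerVertex := by
  refine le_trans ?_ (avgTrap_le_limitPerVertex (M := 32) (K := 8) (by norm_num) (by norm_num))
  have hsum : (trapezoidSum : ℝ) ≤ 10 ^ 10 * (∑ i ∈ Finset.range 33, (trapWeight 32 i : ℝ) *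
      ∑ j ∈ Finset.range 9, (trapWeight 8 j : ℝ) *
      siteDensity (Real.cos ((2 * i : ℕ) * (Real.pi / 64)))
        (Real.cos ((8 * j : ℕ) * (Real.pi / 64)))) := by
    simp only [trapezoidSum, forceInt_eq, sumBelow_eq, Nat.cast_sum, Nat.cast_mul]
    rw [Finset.mul_sum]
    refine Finset.sum_le_sum fun i hi => ?_
    rw [mul_left_comm, Finset.mul_sum, Finset.mul_sum, Finset.mul_sum]
    refine Finset.sum_le_sum fun j hj => ?_
    apply mul_le_mul_of_nonneg_left _ (Nat.cast_nonneg (α := ℝ) _)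
    rw [mul_left_comm]
    apply mul_le_mul_of_nonneg_left _ (Nat.cast_nonneg (α := ℝ) _)
    rw [Finset.mem_range] at hi hj
    have h1 := cosScaled_spec (k := 2 * i) (by omega)
    have h2 := cosScaled_spec (k := 8 * j) (by omega)
    rw [Nat.cast_mul] at h1 h2
    exact densityFloor_le (Real.abs_cos_le_one _) (Real.abs_cos_le_one _) h1 h2
  have hle : 21524600000 * 1024 ≤ (trapezoidSum : ℝ) := by exact_mod_cast lt_trapezoidSum
  -- The doubled weights give the denominator (2 · 32)(2 · 8) = 1024.
  have heq : doubleAverage (avgTrap 32) (avgTrap 8) siteDensity =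
      (∑ i ∈ Finset.range 33, (trapWeight 32 i : ℝ) *
      ∑ j ∈ Finset.range 9, (trapWeight 8 j : ℝ) *
      siteDensity (Real.cos ((2 * i : ℕ) * (Real.pi / 64)))
        (Real.cos ((8 * j : ℕ) * (Real.pi / 64)))) / 1024 := by
    have h : ∀ (M : ℕ), 0 < M → ∀ f : ℝ → ℝ, avgTrap M f =
        (∑ j ∈ Finset.range (M + 1), (trapWeight M j : ℝ) * f (j * (Real.pi / M))) / (2 * M) :=
      fun M hM f => by
        rw [avgTrap, ← sum_add_sum_succ_eq_trapWeight hM fun j => f (j * (Real.pi / M))]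
    rw [doubleAverage, h 32 (by norm_num)]
    simp only [h 8 (by norm_num), mul_div_assoc', ← Finset.sum_div, div_div]
    congr 1
    · refine Finset.sum_congr rfl fun i _ => ?_
      congr 1
      refine Finset.sum_congr rfl fun j _ => ?_
      congr 3
      · push_cast; ring
      · push_cast; ring
    · norm_num
  rw [heq]
  linarith

theorem abs_limitPerVertex_sub_lt : |limitPerVertex - 2.1525| < 0.00005 := by
  have h1 := limitPerVertex_le
  have h2 := le_limitPerVertex
  rw [abs_lt]
  constructor <;> linarith

/-! ### Block-circulant matrices -/

section BlockCirculant

variable {ι Γ T : Type*} [Fintype ι] [Fintype Γ] [AddCommGroup Γ]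

/-- The block matrix whose block at `(a, b)` depends only on `b - a`. -/
def blockCirculant (A : Γ → Matrix ι ι ℂ) : Matrix (ι × Γ) (ι × Γ) ℂ :=
  Matrix.of fun x y => A (y.2 - x.2) x.1 y.1

/-- The Fourier transform of the blocks. -/
noncomputable def blockSymbol (χ : T → Γ → ℂ) (A : Γ → Matrix ι ι ℂ) (t : T) : Matrix ι ι ℂ :=
  ∑ d, χ t d • A d

theorem blockCirculant_mul (A B : Γ → Matrix ι ι ℂ) :
    blockCirculant A * blockCirculant B = blockCirculant fun d => ∑ e, A e * B (d - e) := by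
  ext ⟨i, a⟩ ⟨j, b⟩
  simp only [blockCirculant, Matrix.mul_apply, Matrix.of_apply, Fintype.sum_prod_type,
    Matrix.sum_apply]
  rw [Finset.sum_comm]
  refine Fintype.sum_equiv (Equiv.subRight a) _ _ fun c => ?_
  simp

theorem blockSymbol_conv {χ : T → Γ → ℂ} (hχ : ∀ t d e, χ t (d + e) = χ t d * χ t e)
    (A B : Γ → Matrix ι ι ℂ) (t : T) :
    blockSymbol χ (fun d => ∑ e, A e * B (d - e)) t = blockSymbol χ A t * blockSymbol χ B t := by
  simp only [blockSymbol, Finset.smul_sum, Finset.sum_mul, Finset.mul_sum]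
  rw [Finset.sum_comm]
  conv_rhs => rw [Finset.sum_comm]
  refine Finset.sum_congr rfl fun e _ => ?_
  refine Fintype.sum_equiv (Equiv.subRight e) _ _ fun d => ?_
  rw [Equiv.subRight_apply, Matrix.smul_mul, Matrix.mul_smul, smul_smul, mul_comm, ← hχ]
  simp

/-- Powers stay block-circulant, with blocks given by convolution, and the symbol turns convolution
into products. The trace sees only the block at 0, which orthogonality of the characters recovers
from the symbols; nothing has to be diagonalized. -/
theorem trace_blockCirculant_pow [DecidableEq ι] [DecidableEq Γ] [Fintype T] {χ : T → Γ → ℂ} (hχ : ∀ t d e, χ t (d + e) = χ t d * χ t e)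
    (hχ0 : ∀ t, χ t 0 = 1)
    (horth : ∀ d, ∑ t, χ t d = if d = 0 then (Fintype.card Γ : ℂ) else 0)
    (A : Γ → Matrix ι ι ℂ) (k : ℕ) :
    (blockCirculant A ^ k).trace = ∑ t, (blockSymbol χ A t ^ k).trace := by
  obtain ⟨B, hB, hBs⟩ : ∃ B, blockCirculant A ^ k = blockCirculant B ∧
      ∀ t, blockSymbol χ B t = blockSymbol χ A t ^ k := by
    induction k with
    | zero =>
      refine ⟨fun d => if d = 0 then 1 else 0, ?_, fun t => ?_⟩
      · ext ⟨i, a⟩ ⟨j, b⟩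
        by_cases h : a = b
        · simp [blockCirculant, Matrix.one_apply, h]
        · have : ¬ b - a = 0 := fun h' => h (sub_eq_zero.1 h').symm
          simp [blockCirculant, h, this]
      · simp [blockSymbol, hχ0]
    | succ k ih =>
      obtain ⟨B, hB, hBs⟩ := ih
      refine ⟨_, by rw [pow_succ, hB, blockCirculant_mul], fun t => ?_⟩
      rw [blockSymbol_conv hχ, hBs, pow_succ]
  rw [hB]
  simp only [← hBs]
  simp only [blockSymbol, ← Matrix.trace_sum]
  rw [Finset.sum_comm]
  simp only [← Finset.sum_smul, horth]
  simp only [ite_smul, zero_smul, Finset.sum_ite_eq', Finset.mem_univ, if_true,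
    Matrix.trace_smul]
  simp only [Matrix.trace, Matrix.diag, blockCirculant, Matrix.of_apply, Fintype.sum_prod_type,
    sub_self, Finset.sum_const, Finset.card_univ, Finset.mul_sum, nsmul_eq_mul, smul_eq_mul]

end BlockCirculant

/-- The characters of the cyclic group `Fin n`. -/
noncomputable def finCharacter {n : ℕ} (ω : ℂ) (t d : Fin n) : ℂ := ω ^ ((t : ℕ) * (d : ℕ))

theorem finCharacter_add {n : ℕ} {ω : ℂ} (hω : ω ^ n = 1) (t d e : Fin n) :
    finCharacter ω t (d + e) = finCharacter ω t d * finCharacter ω t e := by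
  have h : ∀ x : ℕ, ω ^ (x % n) = ω ^ x := fun x => by
    conv_rhs => rw [← Nat.mod_add_div x n, pow_add, pow_mul, hω, one_pow, mul_one]
  simp only [finCharacter, Fin.val_add]
  rw [mul_comm, pow_mul, h, ← pow_mul, ← pow_add]
  congr 1; ring

theorem sum_finCharacter {n : ℕ} [NeZero n] {ω : ℂ} (hω : IsPrimitiveRoot ω n) (d : Fin n) :
    ∑ t : Fin n, finCharacter ω t d = if d = 0 then (Fintype.card (Fin n) : ℂ) else 0 := by
  split_ifs with h
  · simp [finCharacter, h]
  · simp only [finCharacter]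
    rw [Fin.sum_univ_eq_sum_range (fun t => ω ^ (t * (d : ℕ)))]
    have h1 : ω ^ (d : ℕ) ≠ 1 :=
      hω.pow_ne_one_of_pos_of_lt (fun h0 => h (Fin.ext (by simpa using h0))) d.2
    have h2 := geom_sum_eq h1 n
    rw [← pow_mul, mul_comm, pow_mul, hω.pow_eq_one, one_pow, sub_self, zero_div] at h2
    rw [← h2]
    refine Finset.sum_congr rfl fun t _ => ?_
    rw [← pow_mul, mul_comm]

/-! ### Traces of powers under perturbation -/

section RowSums

variable {V : Type*} [Fintype V]

/-- All absolute row sums are at most `C`. -/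
def RowSumsLE (A : Matrix V V ℝ) (C : ℝ) : Prop := ∀ u, ∑ v, |A u v| ≤ C

theorem RowSumsLE.abs_apply_le {A : Matrix V V ℝ} {C : ℝ} (h : RowSumsLE A C) (u v : V) :
    |A u v| ≤ C :=
  (Finset.single_le_sum (f := fun v => |A u v|) (fun _ _ => abs_nonneg _)
    (Finset.mem_univ v)).trans (h u)

theorem RowSumsLE.mul {A B : Matrix V V ℝ} {C D : ℝ} (hA : RowSumsLE A C) (hB : RowSumsLE B D)
    (hD : 0 ≤ D) : RowSumsLE (A * B) (C * D) := by
  intro u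
  calc ∑ v, |(A * B) u v| ≤ ∑ v, ∑ w, |A u w| * |B w v| := by
        refine Finset.sum_le_sum fun v _ => ?_
        rw [Matrix.mul_apply]
        refine (Finset.abs_sum_le_sum_abs _ _).trans (le_of_eq ?_)
        simp only [abs_mul]
    _ = ∑ w, |A u w| * ∑ v, |B w v| := by
        rw [Finset.sum_comm]; simp only [Finset.mul_sum]
    _ ≤ ∑ w, |A u w| * D :=
        Finset.sum_le_sum fun w _ => mul_le_mul_of_nonneg_left (hB w) (abs_nonneg _)
    _ = (∑ w, |A u w|) * D := by rw [Finset.sum_mul]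
    _ ≤ C * D := mul_le_mul_of_nonneg_right (hA u) hD

theorem RowSumsLE.one [DecidableEq V] : RowSumsLE (1 : Matrix V V ℝ) 1 := by
  intro u
  simp [Matrix.one_apply, apply_ite abs]

theorem RowSumsLE.pow [DecidableEq V] {A : Matrix V V ℝ} {C : ℝ} (hA : RowSumsLE A C) (hC : 0 ≤ C) (k : ℕ) :
    RowSumsLE (A ^ k) (C ^ k) := by
  induction k with
  | zero => simpa using RowSumsLE.one
  | succ k ih => rw [pow_succ, pow_succ]; exact ih.mul hA hC

theorem abs_trace_mul_le {Y X : Matrix V V ℝ} {C : ℝ} (hY : RowSumsLE Y C) :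
    |(Y * X).trace| ≤ C * ∑ u, ∑ v, |X u v| := by
  simp only [Matrix.trace, Matrix.diag, Matrix.mul_apply]
  calc |∑ u, ∑ v, Y u v * X v u| ≤ ∑ u, ∑ v, |Y u v| * |X v u| := by
        refine (Finset.abs_sum_le_sum_abs _ _).trans (Finset.sum_le_sum fun u _ => ?_)
        refine (Finset.abs_sum_le_sum_abs _ _).trans (le_of_eq ?_)
        simp only [abs_mul]
    _ ≤ ∑ u, ∑ v, C * |X v u| := Finset.sum_le_sum fun u _ => Finset.sum_le_sum fun v _ =>
        mul_le_mul_of_nonneg_right (hY.abs_apply_le u v) (abs_nonneg _)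
    _ = C * ∑ u, ∑ v, |X u v| := by
        rw [Finset.sum_comm]; simp only [Finset.mul_sum]

/-- Telescoping A^(k+1) - B^(k+1) gives k + 1 terms, each containing A - B once. The bound thus
scales with the number of changed entries, not with the size of the matrix. -/
theorem abs_trace_pow_sub_le [DecidableEq V] {A B : Matrix V V ℝ} {C : ℝ} (hA : RowSumsLE A C)
    (hB : RowSumsLE B C) (hC : 0 ≤ C) (k : ℕ) :
    |(A ^ (k + 1)).trace - (B ^ (k + 1)).trace| ≤
      (k + 1) * C ^ k * ∑ u, ∑ v, |(A - B) u v| := by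
  -- The free factor `Y` closes the induction: cyclicity of the trace absorbs the trailing `B` into
  -- it.
  have key : ∀ (k : ℕ) (Y : Matrix V V ℝ) (D : ℝ), 0 ≤ D → RowSumsLE Y D →
      |(Y * (A ^ (k + 1) - B ^ (k + 1))).trace| ≤
        D * ((k + 1) * C ^ k) * ∑ u, ∑ v, |(A - B) u v| := by
    intro k
    induction k with
    | zero =>
      intro Y D _ hY
      simpa using abs_trace_mul_le (X := A - B) hY
    | succ k ih =>
      intro Y D hD hY
      have e : Y * (A ^ (k + 1 + 1) - B ^ (k + 1 + 1)) =
          Y * A ^ (k + 1) * (A - B) + Y * (A ^ (k + 1) - B ^ (k + 1)) * B := by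
        simp only [pow_succ _ (k + 1), mul_sub, sub_mul, mul_assoc]
        abel
      rw [e, Matrix.trace_add, Matrix.trace_mul_comm _ B, ← mul_assoc]
      have h1 := abs_trace_mul_le (X := A - B) (hY.mul (hA.pow hC (k + 1)) (by positivity))
      have h2 := ih (B * Y) (C * D) (by positivity) (hB.mul hY hD)
      refine (abs_add_le _ _).trans ((add_le_add h1 h2).trans (le_of_eq ?_))
      push_cast
      ring
  have := key k 1 1 zero_le_one RowSumsLE.one
  rwa [one_mul, Matrix.trace_sub, one_mul] at this

end RowSums

/-! ### Eigenvalues -/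

section Spectrum

variable {V : Type*} [Fintype V] [DecidableEq V]

theorem sum_eigenvalues₀_pow {A : Matrix V V ℝ} (hA : A.IsHermitian) (k : ℕ) :
    ∑ i, hA.eigenvalues₀ i ^ k = (A ^ k).trace := by
  have h1 : ∑ i, hA.eigenvalues₀ i ^ k = ∑ v, hA.eigenvalues v ^ k :=
    (Fintype.sum_equiv (Fintype.equivOfCardEq (Fintype.card_fin _)).symm _ _ fun v => rfl).symm
  rw [h1]
  conv_rhs => rw [hA.spectral_theorem, ← map_pow, Unitary.conjStarAlgAut_apply,
    Matrix.trace_mul_comm, ← mul_assoc, Unitary.coe_star_mul_self, one_mul, Matrix.diagonal_pow,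
    Matrix.trace_diagonal]
  rfl

/-- Gershgorin's circle theorem. -/
theorem eigenvalues₀_le_of_rowSumsLE {A : Matrix V V ℝ} (hA : A.IsHermitian) {C : ℝ}
    (h : RowSumsLE A C) (i : Fin (Fintype.card V)) : hA.eigenvalues₀ i ≤ C := by
  have hi : hA.eigenvalues₀ i =
      hA.eigenvalues (Fintype.equivOfCardEq (Fintype.card_fin _) i) := by
    simp [Matrix.IsHermitian.eigenvalues]
  rw [hi]
  have hs := hA.eigenvalues_mem_spectrum_real (Fintype.equivOfCardEq (Fintype.card_fin _) i)
  rw [← Matrix.spectrum_toLin', ← Module.End.hasEigenvalue_iff_mem_spectrum] at hs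
  obtain ⟨v, hv⟩ := eigenvalue_mem_ball hs
  rw [Metric.mem_closedBall, Real.dist_eq] at hv
  have h2 := h v
  rw [← Finset.add_sum_erase _ _ (Finset.mem_univ v)] at h2
  simp only [Real.norm_eq_abs] at hv
  have h3 := (abs_le.1 hv).2
  have h4 := le_abs_self (A v v)
  linarith

end Spectrum

/-! ### The Laplacian of the lattice -/

/-- The real Laplacian matrix of a finite graph. -/
noncomputable def laplacian {V : Type*} [Fintype V] [DecidableEq V] (G : SimpleGraph V) :
    Matrix V V ℝ :=
  letI : DecidableRel G.Adj := Classical.decRel G.Adj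
  G.lapMatrix ℝ

open Classical in
theorem laplacian_apply {V : Type*} [Fintype V] [DecidableEq V] (G : SimpleGraph V) (u v : V) :
    laplacian G u v = (if u = v then ∑ w, (if G.Adj u w then (1 : ℝ) else 0) else 0) -
      if G.Adj u v then 1 else 0 := by
  have h := @SimpleGraph.degree_eq_sum_if_adj V _ G (Classical.decRel G.Adj) ℝ _ u
  simp only [laplacian, SimpleGraph.lapMatrix, SimpleGraph.degMatrix, Matrix.sub_apply,
    Matrix.diagonal_apply, SimpleGraph.adjMatrix_apply]
  congr 1
  rw [h]

open Classical in
theorem rowSumsLE_laplacian {V : Type*} [Fintype V] [DecidableEq V] (G : SimpleGraph V) {D : ℝ}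
    (hD : ∀ u, ∑ w, (if G.Adj u w then (1 : ℝ) else 0) ≤ D) :
    RowSumsLE (laplacian G) (2 * D) := by
  intro u
  have hnn : 0 ≤ ∑ w, (if G.Adj u w then (1 : ℝ) else 0) :=
    Finset.sum_nonneg fun w _ => by split_ifs <;> norm_num
  calc ∑ v, |laplacian G u v|
      ≤ ∑ v, ((if u = v then ∑ w, (if G.Adj u w then (1 : ℝ) else 0) else 0) +
          if G.Adj u v then 1 else 0) := by
        refine Finset.sum_le_sum fun v _ => ?_
        rw [laplacian_apply]
        refine (abs_sub _ _).trans (le_of_eq ?_)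
        congr 1
        · split_ifs
          · exact abs_of_nonneg hnn
          · exact abs_zero
        · split_ifs <;> simp
    _ = 2 * ∑ w, (if G.Adj u w then (1 : ℝ) else 0) := by
        rw [Finset.sum_add_distrib, Finset.sum_ite_eq]
        simp only [Finset.mem_univ, if_true]
        ring
    _ ≤ 2 * D := by linarith [hD u]

/-- Rows `r` and `s` are joined by vertical edges. -/
def VertStep (vert : Bool) {k : ℕ} (r s : Fin k) : Prop :=
  r ≠ s ∧ (LatticeStep vert r s ∨ LatticeStep vert s r)

/-- Row `r` is joined to row `s` by edges that lead one column to the right. -/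
def RightStep {k : ℕ} (r s : Fin k) : Prop :=
  r = s ∨ (Even (s : ℕ) ∧ (s : ℕ) + 1 = r)

theorem latticeStep_true_iff {n : ℕ} [NeZero n] (c d : Fin n) :
    LatticeStep true c d ↔ d = c + 1 := by
  have hc := c.2
  have hd := d.2
  rw [Fin.ext_iff, Fin.val_add, Fin.val_one', LatticeStep]
  rcases Nat.lt_or_ge 1 n with hn | hn
  · rw [Nat.mod_eq_of_lt hn]
    rcases Nat.lt_or_ge ((c : ℕ) + 1) n with h | h
    · rw [Nat.mod_eq_of_lt h]; simp; omega
    · have : (c : ℕ) + 1 = n := by omega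
      rw [this, Nat.mod_self]; simp; omega
  · have : n = 1 := by omega
    subst this
    simp

theorem fin_one_ne {n : ℕ} [NeZero n] (hn : 3 ≤ n) :
    (1 : Fin n) ≠ 0 ∧ (-1 : Fin n) ≠ 0 ∧ (1 : Fin n) ≠ -1 := by
  obtain ⟨n, rfl⟩ : ∃ k, n = k + 3 := ⟨n - 3, by omega⟩
  refine ⟨?_, ?_, ?_⟩
  · simp
  · simp
  · intro h
    have h2 : (1 : Fin (n + 3)) + 1 = 0 := by
      nth_rw 1 [h]; exact neg_add_cancel 1
    have h3 := congrArg Fin.val h2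
    rw [Fin.val_add, Fin.val_one, Nat.mod_eq_of_lt (by omega)] at h3
    simp at h3

/-- With the horizontal wrap-around, adjacency depends on the columns only through d - c, whatever
the vertical boundary; this makes the Laplacian block-circulant. -/
theorem lattice3342_adj_iff (vert : Bool) {n m : ℕ} [NeZero n] (hn : 3 ≤ n)
    (r s : Fin (2 * m)) (c d : Fin n) :
    (lattice3342 vert true n m).Adj (r, c) (s, d) ↔
      (d - c = 0 ∧ VertStep vert r s) ∨ (d - c = 1 ∧ RightStep r s) ∨
        (d - c = -1 ∧ RightStep s r) := by
  obtain ⟨h1, h2, h3⟩ := fin_one_ne hn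
  have e0 : d - c = 0 ↔ c = d := by rw [sub_eq_zero, eq_comm]
  have e1 : d - c = 1 ↔ d = c + 1 := by rw [sub_eq_iff_eq_add, add_comm]
  have e2 : d - c = -1 ↔ c = d + 1 := by
    rw [sub_eq_iff_eq_add, neg_add_eq_sub, eq_sub_iff_add_eq, eq_comm]
  have n1 : ∀ a : Fin n, a ≠ a + 1 := fun a h => h1 (by simpa using h.symm)
  rw [e0, e1, e2, lattice3342, SimpleGraph.fromRel_adj]
  simp only [latticeStep_true_iff, VertStep, RightStep, ne_eq, Prod.mk.injEq]
  constructor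
  · rintro ⟨hne, (⟨rfl, hd⟩ | ⟨rfl, hs⟩ | ⟨he, hs, hd⟩) | (⟨rfl, hd⟩ | ⟨rfl, hs⟩ | ⟨he, hs, hd⟩)⟩
    · exact Or.inr (Or.inl ⟨hd, Or.inl rfl⟩)
    · exact Or.inl ⟨rfl, fun h => hne ⟨h, rfl⟩, Or.inl hs⟩
    · exact Or.inr (Or.inr ⟨hd, Or.inr ⟨he, hs⟩⟩)
    · exact Or.inr (Or.inr ⟨hd, Or.inl rfl⟩)
    · exact Or.inl ⟨rfl, fun h => hne ⟨h, rfl⟩, Or.inr hs⟩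
    · exact Or.inr (Or.inl ⟨hd, Or.inr ⟨he, hs⟩⟩)
  · rintro (⟨rfl, hne, hs | hs⟩ | ⟨rfl, rfl | ⟨he, hs⟩⟩ | ⟨rfl, rfl | ⟨he, hs⟩⟩)
    · exact ⟨fun h => hne h.1, Or.inl (Or.inr (Or.inl ⟨rfl, hs⟩))⟩
    · exact ⟨fun h => hne h.1, Or.inr (Or.inr (Or.inl ⟨rfl, hs⟩))⟩
    · exact ⟨fun h => n1 _ h.2, Or.inl (Or.inl ⟨rfl, rfl⟩)⟩
    · exact ⟨fun h => n1 _ h.2, Or.inr (Or.inr (Or.inr ⟨he, hs, rfl⟩))⟩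
    · exact ⟨fun h => n1 _ h.2.symm, Or.inr (Or.inl ⟨rfl, rfl⟩)⟩
    · exact ⟨fun h => n1 _ h.2.symm, Or.inl (Or.inr (Or.inr ⟨he, hs, rfl⟩))⟩

open Classical in
-- For n ≥ 3 the differences 0, 1 and -1 are distinct, so the indicators of the three cases add.
theorem lattice3342_adj_ite (vert : Bool) {n m : ℕ} [NeZero n] (hn : 3 ≤ n)
    (r s : Fin (2 * m)) (c d : Fin n) :
    (if (lattice3342 vert true n m).Adj (r, c) (s, d) then (1 : ℝ) else 0) =
      (if d - c = 0 then (if VertStep vert r s then 1 else 0) else 0) +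
      (if d - c = 1 then (if RightStep r s then 1 else 0) else 0) +
      (if d - c = -1 then (if RightStep s r then 1 else 0) else 0) := by
  obtain ⟨h1, h2, h3⟩ := fin_one_ne hn
  rw [lattice3342_adj_iff vert hn]
  by_cases a : d - c = 0
  · simp [a, h1.symm, h2.symm]
  · by_cases b : d - c = 1
    · simp [b, h1, h3]
    · simp [a, b, ← ite_and]

open Classical in
/-- The number of neighbours of a vertex in row `r`. -/
noncomputable def rowDegree (vert : Bool) {k : ℕ} (r : Fin k) : ℝ :=
  ∑ s, ((if VertStep vert r s then 1 else 0) + (if RightStep r s then 1 else 0) +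
    (if RightStep s r then 1 else 0))

open Classical in
theorem lattice3342_degree (vert : Bool) {n m : ℕ} [NeZero n] (hn : 3 ≤ n)
    (r : Fin (2 * m)) (c : Fin n) :
    ∑ w, (if (lattice3342 vert true n m).Adj (r, c) w then (1 : ℝ) else 0) = rowDegree vert r := by
  rw [Fintype.sum_prod_type, rowDegree]
  refine Finset.sum_congr rfl fun s _ => ?_
  simp only [lattice3342_adj_ite vert hn, Finset.sum_add_distrib, sub_eq_iff_eq_add,
    Finset.sum_ite_eq', Finset.mem_univ, if_true]

open Classical in
/-- The blocks of the Laplacian with respect to the columns. -/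
noncomputable def columnBlocks (vert : Bool) (n m : ℕ) [NeZero n] (d : Fin n) :
    Matrix (Fin (2 * m)) (Fin (2 * m)) ℂ :=
  (if d = 0 then Matrix.of fun r s => ((if r = s then (rowDegree vert r : ℂ) else 0) -
      if VertStep vert r s then 1 else 0) else 0) -
    (if d = 1 then Matrix.of fun r s => if RightStep r s then 1 else 0 else 0) -
    (if d = -1 then Matrix.of fun r s => if RightStep s r then 1 else 0 else 0)

theorem laplacian_lattice3342_map (vert : Bool) {n m : ℕ} [NeZero n] (hn : 3 ≤ n) :
    (laplacian (lattice3342 vert true n m)).map Complex.ofRealHom =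
      blockCirculant (columnBlocks vert n m) := by
  classical
  ext ⟨r, c⟩ ⟨s, d⟩
  simp only [Matrix.map_apply, blockCirculant, Matrix.of_apply, columnBlocks]
  rw [laplacian_apply]
  have h1 := lattice3342_adj_ite vert hn r s c d
  have h2 := lattice3342_degree vert hn r c
  have h1' : (if (lattice3342 vert true n m).Adj (r, c) (s, d) then (1 : ℝ) else 0) = _ := h1
  rw [h2, h1']
  simp only [Matrix.sub_apply, apply_ite (fun M : Matrix (Fin (2 * m)) (Fin (2 * m)) ℂ => M r s),
    Matrix.of_apply, Matrix.zero_apply, Complex.ofRealHom_eq_coe, Complex.ofReal_sub,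
    Complex.ofReal_add, apply_ite Complex.ofReal, Complex.ofReal_one, Complex.ofReal_zero,
    Prod.mk.injEq]
  by_cases h : d - c = 0
  · obtain rfl : c = d := (sub_eq_zero.1 h).symm
    simp only [sub_self, if_true, and_true]
    split_ifs <;> ring
  · have hcd : c ≠ d := fun h' => h (by rw [h', sub_self])
    simp only [h, hcd, and_false, if_false]
    split_ifs <;> ring

open Classical in
/-- The Fourier transform of the Laplacian in the direction of the columns. -/
noncomputable def columnSymbol (vert : Bool) (m : ℕ) (z : ℂ) :
    Matrix (Fin (2 * m)) (Fin (2 * m)) ℂ :=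
  Matrix.of fun r s => (if r = s then (rowDegree vert r : ℂ) else 0) -
    (if VertStep vert r s then 1 else 0) - z * (if RightStep r s then 1 else 0) -
    z⁻¹ * (if RightStep s r then 1 else 0)

theorem finCharacter_one_neg_one {n : ℕ} [NeZero n] (hn : 2 ≤ n) {ω : ℂ} (hω : ω ^ n = 1)
    (t : Fin n) : finCharacter ω t 0 = 1 ∧ finCharacter ω t 1 = ω ^ (t : ℕ) ∧
      finCharacter ω t (-1) = (ω ^ (t : ℕ))⁻¹ := by
  have h0 : finCharacter ω t 0 = 1 := by simp [finCharacter]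
  have h1 : finCharacter ω t 1 = ω ^ (t : ℕ) := by
    rw [finCharacter, Fin.val_one', Nat.mod_eq_of_lt hn, mul_one]
  refine ⟨h0, h1, ?_⟩
  have h := finCharacter_add hω t 1 (-1)
  rw [add_neg_cancel, h0, h1] at h
  exact eq_inv_of_mul_eq_one_right h.symm

theorem trace_laplacian_pow (vert : Bool) {n m : ℕ} [NeZero n] (hn : 3 ≤ n) {ω : ℂ}
    (hω : IsPrimitiveRoot ω n) (k : ℕ) :
    (((laplacian (lattice3342 vert true n m) ^ k).trace : ℝ) : ℂ) =
      ∑ t : Fin n, (columnSymbol vert m (ω ^ (t : ℕ)) ^ k).trace := by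
  classical
  have h := trace_blockCirculant_pow (finCharacter_add hω.pow_eq_one)
    (fun t => (finCharacter_one_neg_one (by omega) hω.pow_eq_one t).1) (sum_finCharacter hω)
    (columnBlocks vert n m) k
  rw [← laplacian_lattice3342_map vert hn] at h
  have h2 : (((laplacian (lattice3342 vert true n m) ^ k).trace : ℝ) : ℂ) =
      ((laplacian (lattice3342 vert true n m)).map Complex.ofRealHom ^ k).trace := by
    rw [← Matrix.map_pow]
    exact AddMonoidHom.map_trace Complex.ofRealHom.toAddMonoidHom _
  rw [h2, h]
  refine Finset.sum_congr rfl fun t _ => ?_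
  congr 2
  obtain ⟨e0, e1, e2⟩ := finCharacter_one_neg_one (by omega) hω.pow_eq_one t
  simp only [blockSymbol, columnBlocks, smul_sub, smul_ite, smul_zero, Finset.sum_sub_distrib,
    Finset.sum_ite_eq', Finset.mem_univ, if_true, e0, e1, e2]
  ext r s
  simp [columnSymbol]

/-! ### The symbol of the torus -/

/-- The rows in pairs: `(i, a)` is the row `2a + i`. -/
def rowEquiv (m : ℕ) : Fin 2 × Fin m ≃ Fin (2 * m) :=
  (Equiv.prodComm _ _).trans (finProdFinEquiv.trans (finCongr (Nat.mul_comm m 2)))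

theorem rowEquiv_val {m : ℕ} (i : Fin 2) (a : Fin m) :
    (rowEquiv m (i, a) : ℕ) = i + 2 * a := by
  simp [rowEquiv]

theorem sub_eq_one_iff {m : ℕ} [NeZero m] (a b : Fin m) :
    b - a = 1 ↔ (a : ℕ) + 1 = b ∨ ((a : ℕ) + 1 = m ∧ (b : ℕ) = 0) := by
  have h := latticeStep_true_iff a b
  rw [LatticeStep] at h
  rw [sub_eq_iff_eq_add, add_comm, ← h]
  simp

theorem sub_eq_neg_one_iff {m : ℕ} [NeZero m] (a b : Fin m) :
    b - a = -1 ↔ (b : ℕ) + 1 = a ∨ ((b : ℕ) + 1 = m ∧ (a : ℕ) = 0) := by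
  rw [← sub_eq_one_iff, ← neg_sub, neg_inj]

theorem sub_eq_zero_iff_val {m : ℕ} [NeZero m] (a b : Fin m) :
    b - a = 0 ↔ (a : ℕ) = b := by
  rw [sub_eq_zero, Fin.ext_iff, eq_comm]

section
variable {m : ℕ} (a b : Fin m)

theorem vertStep_same (i : Fin 2) : ¬ VertStep true (rowEquiv m (i, a)) (rowEquiv m (i, b)) := by
  simp only [VertStep, LatticeStep, rowEquiv_val]
  omega

theorem vertStep_zero_one [NeZero m] : VertStep true (rowEquiv m (0, a)) (rowEquiv m (1, b)) ↔
    b - a = 0 ∨ b - a = -1 := by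
  rw [sub_eq_zero_iff_val, sub_eq_neg_one_iff]
  have ha := a.2
  have hb := b.2
  simp only [VertStep, LatticeStep, rowEquiv_val, ne_eq, Fin.ext_iff, Fin.val_zero, Fin.val_one,
    true_and]
  omega

theorem vertStep_one_zero [NeZero m] : VertStep true (rowEquiv m (1, a)) (rowEquiv m (0, b)) ↔
    b - a = 0 ∨ b - a = 1 := by
  rw [sub_eq_zero_iff_val, sub_eq_one_iff]
  have ha := a.2
  have hb := b.2
  simp only [VertStep, LatticeStep, rowEquiv_val, ne_eq, Fin.ext_iff, Fin.val_zero, Fin.val_one,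
    true_and]
  omega

theorem rightStep_same [NeZero m] (i : Fin 2) : RightStep (rowEquiv m (i, a)) (rowEquiv m (i, b)) ↔
    b - a = 0 := by
  rw [sub_eq_zero_iff_val]
  simp only [RightStep, rowEquiv_val, Fin.ext_iff]
  omega

theorem rightStep_one_zero [NeZero m] : RightStep (rowEquiv m (1, a)) (rowEquiv m (0, b)) ↔ b - a = 0 := by
  rw [sub_eq_zero_iff_val]
  simp only [RightStep, rowEquiv_val, Fin.ext_iff, Fin.val_zero, Fin.val_one, Nat.even_iff]
  omega

theorem not_rightStep_zero_one : ¬ RightStep (rowEquiv m (0, a)) (rowEquiv m (1, b)) := by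
  simp only [RightStep, rowEquiv_val, Fin.ext_iff, Fin.val_zero, Fin.val_one, Nat.even_iff]
  omega

end

theorem fin_one_ne_zero {m : ℕ} [NeZero m] (hm : 2 ≤ m) : (1 : Fin m) ≠ 0 := by
  obtain ⟨m, rfl⟩ : ∃ k, m = k + 2 := ⟨m - 2, by omega⟩
  simp

theorem ite_or_eq_add {R : Type*} [AddMonoidWithOne R] {p q : Prop} [Decidable p] [Decidable q]
    [Decidable (p ∨ q)] (h : p → ¬ q) : (if p ∨ q then (1 : R) else 0) = (if p then 1 else 0) + if q then 1 else 0 := by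
  by_cases hp : p
  · simp [hp, h hp]
  · simp [hp]

/-- Two vertical neighbours, two horizontal ones and one along a diagonal. For m = 1 the two
vertical neighbours would coincide. -/
theorem rowDegree_true {m : ℕ} (hm : 2 ≤ m) (r : Fin (2 * m)) : rowDegree true r = 5 := by
  classical
  have : NeZero m := ⟨by omega⟩
  have h1 := fin_one_ne_zero hm
  obtain ⟨⟨i, a⟩, rfl⟩ := (rowEquiv m).surjective r
  rw [rowDegree, ← (rowEquiv m).sum_comp, Fintype.sum_prod_type, Fin.sum_univ_two]
  have e1 : ∀ b : Fin m, b - a = 0 → ¬ b - a = -1 := fun b h h' =>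
    h1 (by rw [h] at h'; simpa using h'.symm)
  have e2 : ∀ b : Fin m, b - a = 0 → ¬ b - a = 1 := fun b h h' => h1 (by rw [← h', h])
  have e3 : ∀ b : Fin m, a - b = 0 ↔ b - a = 0 := fun b => by
    rw [sub_eq_zero, sub_eq_zero, eq_comm]
  fin_cases i
  · simp only [Fin.zero_eta, vertStep_same, vertStep_zero_one, rightStep_same, rightStep_one_zero,
      not_rightStep_zero_one, if_false, ite_or_eq_add (e1 _), e3, Finset.sum_add_distrib]
    simp only [sub_eq_iff_eq_add, Finset.sum_ite_eq', Finset.mem_univ, if_true]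
    norm_num
  · simp only [Fin.mk_one, vertStep_same, vertStep_one_zero, rightStep_same, rightStep_one_zero,
      not_rightStep_zero_one, if_false, ite_or_eq_add (e2 _), e3, Finset.sum_add_distrib]
    simp only [sub_eq_iff_eq_add, Finset.sum_ite_eq', Finset.mem_univ, if_true]
    norm_num

/-- The blocks of the column symbol with respect to the pairs of rows. -/
noncomputable def rowBlocks (m : ℕ) [NeZero m] (z : ℂ) (d : Fin m) : Matrix (Fin 2) (Fin 2) ℂ :=
  (if d = 0 then !![5 - z - z⁻¹, -1 - z⁻¹; -1 - z, 5 - z - z⁻¹] else 0) +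
    (if d = 1 then !![0, 0; -1, 0] else 0) + (if d = -1 then !![0, -1; 0, 0] else 0)

/-- The diagonals have period two in the rows, so translation invariance holds for pairs of rows. -/
theorem columnSymbol_submatrix {m : ℕ} [NeZero m] (hm : 2 ≤ m) (z : ℂ) :
    (columnSymbol true m z).submatrix (rowEquiv m) (rowEquiv m) =
      blockCirculant (rowBlocks m z) := by
  classical
  have h1 := fin_one_ne_zero hm
  ext ⟨i, a⟩ ⟨j, b⟩
  have e1 : b - a = 0 → ¬ b - a = -1 := fun h h' =>
    h1 (by rw [h] at h'; simpa using h'.symm)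
  have e2 : b - a = 0 → ¬ b - a = 1 := fun h h' => h1 (by rw [← h', h])
  have e3 : a - b = 0 ↔ b - a = 0 := by rw [sub_eq_zero, sub_eq_zero, eq_comm]
  simp only [Matrix.submatrix_apply, columnSymbol, blockCirculant, Matrix.of_apply, rowBlocks,
    rowDegree_true hm, Matrix.add_apply,
    apply_ite (fun M : Matrix (Fin 2) (Fin 2) ℂ => M i j), (rowEquiv m).injective.eq_iff,
    Prod.mk.injEq, Matrix.zero_apply]
  have e4 : a = b ↔ b - a = 0 := by rw [sub_eq_zero, eq_comm]
  fin_cases i <;> fin_cases j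
  · simp only [Fin.zero_eta, vertStep_same, rightStep_same, if_false, e3, e4, true_and]
    by_cases h : b - a = 0 <;> simp [h]
  · simp only [Fin.zero_eta, Fin.mk_one, vertStep_zero_one, rightStep_one_zero,
      not_rightStep_zero_one, if_false, e3, ite_or_eq_add e1]
    by_cases h : b - a = 0
    · simp [h, show m ≠ 1 by omega]
    · simp [h]
      split_ifs <;> simp
  · simp only [Fin.zero_eta, Fin.mk_one, vertStep_one_zero, rightStep_one_zero,
      not_rightStep_zero_one, if_false, ite_or_eq_add e2]
    by_cases h : b - a = 0
    · simp [h, show m ≠ 1 by omega]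
    · simp [h]
      split_ifs <;> simp
  · simp only [Fin.mk_one, vertStep_same, rightStep_same, if_false, e3, e4, true_and]
    by_cases h : b - a = 0 <;> simp [h]

theorem trace_submatrix_equiv_pow {α β : Type*} [Fintype α] [DecidableEq α] [Fintype β]
    [DecidableEq β] (e : α ≃ β) (A : Matrix β β ℂ) (k : ℕ) :
    (A.submatrix e e ^ k).trace = (A ^ k).trace := by
  have h : A.submatrix e e ^ k = (A ^ k).submatrix e e := by
    induction k with
    | zero => simp
    | succ k ih => rw [pow_succ, pow_succ, ih, Matrix.submatrix_mul_equiv]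
  rw [h]
  exact e.sum_comp fun i => (A ^ k) i i

/-- By Cayley–Hamilton the traces obey the same two-term recurrence as the power sums of a ± s. This
also covers matrices that are not diagonalizable. -/
theorem trace_two_by_two_pow {a u v s : ℂ} (hs : s ^ 2 = u * v) (k : ℕ) :
    (!![a, u; v, a] ^ k).trace = (a - s) ^ k + (a + s) ^ k := by
  have hsq : ∀ k : ℕ, !![a, u; v, a] ^ (k + 2) =
      (2 * a) • !![a, u; v, a] ^ (k + 1) - (a ^ 2 - s ^ 2) • !![a, u; v, a] ^ k := by
    intro k
    have h2 : !![a, u; v, a] * !![a, u; v, a] =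
        (2 * a) • !![a, u; v, a] - (a ^ 2 - s ^ 2) • (1 : Matrix (Fin 2) (Fin 2) ℂ) := by
      rw [hs]
      ext i j
      fin_cases i <;> fin_cases j <;> simp <;> ring
    rw [pow_add, pow_two, h2, mul_sub, mul_smul_comm, mul_smul_comm, mul_one, ← pow_succ]
  have : (!![a, u; v, a] ^ k).trace = (a - s) ^ k + (a + s) ^ k ∧
      (!![a, u; v, a] ^ (k + 1)).trace = (a - s) ^ (k + 1) + (a + s) ^ (k + 1) := by
    induction k with
    | zero =>
      constructor
      · simp; norm_num
      · simp [Matrix.trace_fin_two]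
    | succ k ih =>
      refine ⟨ih.2, ?_⟩
      rw [hsq, Matrix.trace_sub, Matrix.trace_smul, Matrix.trace_smul, ih.1, ih.2, smul_eq_mul,
        smul_eq_mul]
      ring
  exact this.1

/-- The sum of the `k`-th powers of the two branches of the symbol of the torus. -/
noncomputable def torusPowerSum (k : ℕ) (x y : ℝ) : ℝ :=
  (5 - 2 * Real.cos (2 * Real.pi * x) - innerRoot x y) ^ k +
    (5 - 2 * Real.cos (2 * Real.pi * x) + innerRoot x y) ^ k

theorem exp_add_inv_exp (t : ℝ) :
    Complex.exp (t * Complex.I) + (Complex.exp (t * Complex.I))⁻¹ = 2 * (Real.cos t : ℂ) := by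
  rw [← Complex.exp_neg, Complex.ofReal_cos, Complex.cos]
  ring_nf

theorem innerRoot_sq (x y : ℝ) : innerRoot x y ^ 2 =
    3 + 2 * Real.cos (2 * Real.pi * x) + 2 * Real.cos (2 * Real.pi * y)
      + 2 * Real.cos (2 * Real.pi * (x + y)) := by
  have h2 := (innerSq_nonneg (p := Real.cos (Real.pi * x)) (Real.abs_cos_le_one
    (2 * Real.pi * y + Real.pi * x))).1
  have h3 : innerSq (Real.cos (Real.pi * x)) (Real.cos (2 * Real.pi * y + Real.pi * x)) =
    3 + 2 * Real.cos (2 * Real.pi * x) + 2 * Real.cos (2 * Real.pi * y)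
      + 2 * Real.cos (2 * Real.pi * (x + y)) := by
    have h1 : 2 * Real.pi * x = 2 * (Real.pi * x) := by ring
    have h2 : 2 * Real.pi * y = (2 * Real.pi * y + Real.pi * x) - Real.pi * x := by ring
    have h3 : 2 * Real.pi * (x + y) = (2 * Real.pi * y + Real.pi * x) + Real.pi * x := by ring
    rw [innerSq, h1, h3]
    nth_rw 2 [h2]
    rw [Real.cos_two_mul, Real.cos_add (2 * Real.pi * y + Real.pi * x), Real.cos_sub]
    ring
  rw [h3] at h2
  rw [innerRoot, Real.sq_sqrt h2]

/-- On the unit circle the product of the off-diagonal entries is |1 + z + w|², which is the square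
of `innerRoot`. -/
theorem trace_torus_symbol (k : ℕ) (x y : ℝ) {z w : ℂ}
    (hz : z = Complex.exp ((2 * Real.pi * x : ℝ) * Complex.I))
    (hw : w = (Complex.exp ((2 * Real.pi * y : ℝ) * Complex.I))⁻¹) :
    (!![5 - z - z⁻¹, -1 - z⁻¹ - w⁻¹; -1 - z - w, 5 - z - z⁻¹] ^ k).trace =
      (torusPowerSum k x y : ℂ) := by
  have hz0 : z ≠ 0 := hz ▸ Complex.exp_ne_zero _
  have hw0 : w ≠ 0 := hw ▸ inv_ne_zero (Complex.exp_ne_zero _)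
  have h1 : z + z⁻¹ = 2 * (Real.cos (2 * Real.pi * x) : ℂ) := by rw [hz, exp_add_inv_exp]
  have h2 : w + w⁻¹ = 2 * (Real.cos (2 * Real.pi * y) : ℂ) := by
    rw [hw, inv_inv, add_comm, exp_add_inv_exp]
  have h3 : z * w⁻¹ + z⁻¹ * w = 2 * (Real.cos (2 * Real.pi * (x + y)) : ℂ) := by
    have e : z * w⁻¹ = Complex.exp ((2 * Real.pi * (x + y) : ℝ) * Complex.I) := by
      rw [hz, hw, inv_inv, ← Complex.exp_add]; congr 1; push_cast; ring
    rw [← exp_add_inv_exp, ← e, mul_inv, inv_inv]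
  have hs : ((innerRoot x y : ℝ) : ℂ) ^ 2 = (-1 - z⁻¹ - w⁻¹) * (-1 - z - w) := by
    rw [← Complex.ofReal_pow, innerRoot_sq]
    push_cast
    have e1 : (-1 - z⁻¹ - w⁻¹) * (-1 - z - w) =
        1 + z * z⁻¹ + w * w⁻¹ + (z + z⁻¹) + (w + w⁻¹) + (z * w⁻¹ + z⁻¹ * w) := by ring
    rw [e1, h1, h2, h3, mul_inv_cancel₀ hz0, mul_inv_cancel₀ hw0]
    push_cast
    ring
  rw [trace_two_by_two_pow hs, torusPowerSum]
  have ha : 5 - z - z⁻¹ = ((5 - 2 * Real.cos (2 * Real.pi * x) : ℝ) : ℂ) := by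
    push_cast at h1 ⊢; rw [← h1]; ring
  rw [ha]
  push_cast
  ring

theorem exp_root_pow (n t : ℕ) : Complex.exp (2 * Real.pi * Complex.I / n) ^ t =
    Complex.exp ((2 * Real.pi * ((t : ℝ) / n) : ℝ) * Complex.I) := by
  rw [← Complex.exp_nat_mul]
  congr 1
  push_cast
  ring

theorem trace_torus_pow {n m : ℕ} (hn : 3 ≤ n) (hm : 2 ≤ m) (k : ℕ) :
    (laplacian (latticeToroidal n m) ^ k).trace =
      ∑ t ∈ Finset.range n, ∑ l ∈ Finset.range m, torusPowerSum k ((t : ℝ) / n) ((l : ℝ) / m) := by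
  have : NeZero n := ⟨by omega⟩
  have : NeZero m := ⟨by omega⟩
  have hωn := Complex.isPrimitiveRoot_exp n (by omega)
  -- The inverse root makes w = exp(-2πiy), so that z w⁻¹ has the angle 2π(x + y) of `innerRoot`.
  have hωm := (Complex.isPrimitiveRoot_exp m (by omega)).inv
  apply Complex.ofReal_injective
  rw [latticeToroidal, trace_laplacian_pow true hn hωn, Complex.ofReal_sum,
    ← Fin.sum_univ_eq_sum_range (fun t => ((∑ l ∈ Finset.range m,
      torusPowerSum k ((t : ℝ) / n) ((l : ℝ) / m) : ℝ) : ℂ))]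
  refine Finset.sum_congr rfl fun t _ => ?_
  rw [Complex.ofReal_sum, ← Fin.sum_univ_eq_sum_range (fun l : ℕ =>
      ((torusPowerSum k (((t : ℕ) : ℝ) / n) ((l : ℝ) / m) : ℝ) : ℂ)),
    ← trace_submatrix_equiv_pow (rowEquiv m), columnSymbol_submatrix hm,
    trace_blockCirculant_pow (finCharacter_add hωm.pow_eq_one)
      (fun t => (finCharacter_one_neg_one hm hωm.pow_eq_one t).1) (sum_finCharacter hωm)]
  refine Finset.sum_congr rfl fun l _ => ?_
  obtain ⟨e0, e1, e2⟩ := finCharacter_one_neg_one hm hωm.pow_eq_one l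
  rw [← trace_torus_symbol k _ _ (exp_root_pow n t)
    (w := (Complex.exp (2 * Real.pi * Complex.I / m))⁻¹ ^ (l : ℕ)) (by rw [inv_pow, exp_root_pow m l])]
  congr 2
  simp only [blockSymbol, rowBlocks, smul_add, smul_ite, smul_zero, Finset.sum_add_distrib,
    Finset.sum_ite_eq', Finset.mem_univ, if_true, e0, e1, e2]
  ext i j
  fin_cases i <;> fin_cases j <;> simp [sub_eq_add_neg]

/-! ### Comparison of the boundary conditions -/

theorem lattice3342_le (vert horiz : Bool) (n m : ℕ) :
    lattice3342 vert horiz n m ≤ lattice3342 true true n m := by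
  have h : ∀ {k : ℕ} {b : Bool} {i j : Fin k}, LatticeStep b i j → LatticeStep true i j := by
    rintro k b i j (h | ⟨_, h⟩)
    · exact Or.inl h
    · exact Or.inr ⟨rfl, h⟩
  intro p q
  simp only [lattice3342, SimpleGraph.fromRel_adj]
  rintro ⟨hne, h'⟩
  refine ⟨hne, h'.imp ?_ ?_⟩
  all_goals
    rintro (h' | h' | h')
    · exact Or.inl ⟨h'.1, h h'.2⟩
    · exact Or.inr (Or.inl ⟨h'.1, h h'.2⟩)
    · exact Or.inr (Or.inr ⟨h'.1, h'.2.1, h h'.2.2⟩)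

/-- Every variant is a subgraph of the 5-regular torus. -/
theorem rowSumsLE_laplacian_lattice3342 (vert horiz : Bool) {n m : ℕ} (hn : 3 ≤ n) (hm : 2 ≤ m) :
    RowSumsLE (laplacian (lattice3342 vert horiz n m)) 10 := by
  classical
  have : NeZero n := ⟨by omega⟩
  have := rowSumsLE_laplacian (lattice3342 vert horiz n m) (D := 5) (fun u => ?_)
  · norm_num at this; exact this
  · have h := lattice3342_degree true hn u.1 u.2
    rw [rowDegree_true hm] at h
    rw [← h]
    refine Finset.sum_le_sum fun w _ => ?_
    by_cases hw : (lattice3342 vert horiz n m).Adj u w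
    · simp [hw, lattice3342_le vert horiz n m hw]
    · rw [if_neg hw]; split_ifs <;> norm_num

theorem latticeStep_iff_of_interior {k : ℕ} {i : Fin k} (h0 : (i : ℕ) ≠ 0) (h1 : (i : ℕ) + 1 ≠ k)
    (b b' : Bool) (j : Fin k) :
    (LatticeStep b i j ↔ LatticeStep b' i j) ∧ (LatticeStep b j i ↔ LatticeStep b' j i) := by
  simp [LatticeStep, h0, h1]

theorem lattice3342_adj_iff_of_interior {vert horiz vert' horiz' : Bool} {n m : ℕ}
    {u : Fin (2 * m) × Fin n}
    (hr : vert = vert' ∨ ((u.1 : ℕ) ≠ 0 ∧ (u.1 : ℕ) + 1 ≠ 2 * m))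
    (hc : horiz = horiz' ∨ ((u.2 : ℕ) ≠ 0 ∧ (u.2 : ℕ) + 1 ≠ n)) (v : Fin (2 * m) × Fin n) :
    (lattice3342 vert horiz n m).Adj u v ↔ (lattice3342 vert' horiz' n m).Adj u v := by
  have h1 : (LatticeStep vert u.1 v.1 ↔ LatticeStep vert' u.1 v.1) ∧
      (LatticeStep vert v.1 u.1 ↔ LatticeStep vert' v.1 u.1) := by
    rcases hr with rfl | hr
    · exact ⟨Iff.rfl, Iff.rfl⟩
    · exact latticeStep_iff_of_interior hr.1 hr.2 _ _ _
  have h2 : (LatticeStep horiz u.2 v.2 ↔ LatticeStep horiz' u.2 v.2) ∧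
      (LatticeStep horiz v.2 u.2 ↔ LatticeStep horiz' v.2 u.2) := by
    rcases hc with rfl | hc
    · exact ⟨Iff.rfl, Iff.rfl⟩
    · exact latticeStep_iff_of_interior hc.1 hc.2 _ _ _
  simp only [lattice3342, SimpleGraph.fromRel_adj, h1.1, h1.2, h2.1, h2.2]

/-- A row of the Laplacian is determined by the neighbourhood of its vertex, so only the rows in `s`
contribute. -/
theorem sum_abs_laplacian_sub_le {V : Type*} [Fintype V] [DecidableEq V] {G G' : SimpleGraph V}
    {C : ℝ} (hG : RowSumsLE (laplacian G) C) (hG' : RowSumsLE (laplacian G') C)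
    (s : Finset V) (h : ∀ u, u ∉ s → ∀ v, G.Adj u v ↔ G'.Adj u v) :
    ∑ u, ∑ v, |(laplacian G - laplacian G') u v| ≤ 2 * C * s.card := by
  calc ∑ u, ∑ v, |(laplacian G - laplacian G') u v|
      ≤ ∑ u, if u ∈ s then 2 * C else 0 := by
        refine Finset.sum_le_sum fun u _ => ?_
        split_ifs with hu
        · calc ∑ v, |(laplacian G - laplacian G') u v|
              ≤ ∑ v, (|laplacian G u v| + |laplacian G' u v|) :=
                Finset.sum_le_sum fun v _ => abs_sub _ _
            _ ≤ 2 * C := by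
                rw [Finset.sum_add_distrib]; linarith [hG u, hG' u]
        · have hadj : G.Adj u = G'.Adj u := funext fun v => propext (h u hu v)
          refine (Finset.sum_eq_zero fun v _ => ?_).le
          rw [Matrix.sub_apply, laplacian_apply, laplacian_apply, hadj, sub_self, abs_zero]
    _ = 2 * C * s.card := by
        rw [Finset.sum_ite_mem, Finset.univ_inter, Finset.sum_const, nsmul_eq_mul]; ring

/-- The first and the last positions among `0, …, k - 1`. -/
def endPositions (k : ℕ) : Finset (Fin k) :=
  Finset.univ.filter fun i => (i : ℕ) = 0 ∨ (i : ℕ) + 1 = k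

theorem card_endPositions_le (k : ℕ) : (endPositions k).card ≤ 2 := by
  have h : ((endPositions k).map Fin.valEmbedding) ⊆ {0, k - 1} := by
    intro x hx
    simp only [endPositions, Finset.mem_map, Finset.mem_filter, Finset.mem_univ, true_and,
      Fin.valEmbedding_apply] at hx
    obtain ⟨i, hi, rfl⟩ := hx
    simp only [Finset.mem_insert, Finset.mem_singleton]
    omega
  have := Finset.card_le_card h
  rw [Finset.card_map] at this
  exact this.trans Finset.card_le_two

theorem abs_trace_sub_horiz_le (vert horiz : Bool) {n m : ℕ} (hn : 3 ≤ n) (hm : 2 ≤ m) (k : ℕ) :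
    |(laplacian (lattice3342 vert horiz n m) ^ (k + 1)).trace -
      (laplacian (lattice3342 vert true n m) ^ (k + 1)).trace| ≤
      (k + 1) * 10 ^ k * (20 * (4 * m)) := by
  have h1 := rowSumsLE_laplacian_lattice3342 vert horiz hn hm
  have h2 := rowSumsLE_laplacian_lattice3342 vert true hn hm
  refine (abs_trace_pow_sub_le h1 h2 (by norm_num) k).trans ?_
  refine mul_le_mul_of_nonneg_left ?_ (by positivity)
  refine (sum_abs_laplacian_sub_le h1 h2
    (Finset.univ ×ˢ endPositions n) fun u hu v => ?_).trans ?_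
  · apply lattice3342_adj_iff_of_interior (Or.inl rfl) (Or.inr _)
    simpa [endPositions] using hu
  · rw [Finset.card_product, Finset.card_univ, Fintype.card_fin]
    have : ((endPositions n).card : ℝ) ≤ 2 := by exact_mod_cast card_endPositions_le n
    push_cast
    nlinarith [(Nat.cast_nonneg m : (0 : ℝ) ≤ m)]

/-- The affected vertices lie in two columns of length 2m and two rows of length n. -/
theorem abs_trace_sub_torus_le (vert horiz : Bool) {n m : ℕ} (hn : 3 ≤ n) (hm : 2 ≤ m) (k : ℕ) :
    |(laplacian (lattice3342 vert horiz n m) ^ (k + 1)).trace -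
      (laplacian (latticeToroidal n m) ^ (k + 1)).trace| ≤
      (k + 1) * 10 ^ k * (20 * (4 * m + 2 * n)) := by
  have h1 := rowSumsLE_laplacian_lattice3342 vert horiz hn hm
  have h2 := rowSumsLE_laplacian_lattice3342 true true hn hm
  refine (abs_trace_pow_sub_le h1 h2 (by norm_num) k).trans ?_
  refine mul_le_mul_of_nonneg_left ?_ (by positivity)
  refine (sum_abs_laplacian_sub_le h1 h2
    (Finset.univ ×ˢ endPositions n ∪ endPositions (2 * m) ×ˢ Finset.univ)
    fun u hu v => ?_).trans ?_
  · apply lattice3342_adj_iff_of_interior (Or.inr _) (Or.inr _)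
    · simp only [endPositions, Finset.mem_union, Finset.mem_product, Finset.mem_filter,
        Finset.mem_univ, true_and, and_true] at hu
      tauto
    · simp only [endPositions, Finset.mem_union, Finset.mem_product, Finset.mem_filter,
        Finset.mem_univ, true_and, and_true] at hu
      tauto
  · have h := Finset.card_union_le (Finset.univ ×ˢ endPositions n)
      (endPositions (2 * m) ×ˢ (Finset.univ : Finset (Fin n)))
    rw [Finset.card_product, Finset.card_product, Finset.card_univ, Finset.card_univ,
      Fintype.card_fin, Fintype.card_fin] at h
    have e1 := card_endPositions_le n
    have e2 := card_endPositions_le (2 * m)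
    have h3 : (Finset.univ ×ˢ endPositions n ∪
        endPositions (2 * m) ×ˢ (Finset.univ : Finset (Fin n))).card ≤ 4 * m + 2 * n := by
      nlinarith
    have h4 : ((Finset.univ ×ˢ endPositions n ∪
        endPositions (2 * m) ×ˢ (Finset.univ : Finset (Fin n))).card : ℝ) ≤ 4 * m + 2 * n := by
      exact_mod_cast h3
    linarith

/-! ### Means over points of `[0, 10]` -/

/-- A linear functional that is bounded by the supremum over `[0, 10]`. -/
structure IsMean (T : (ℝ → ℝ) → ℝ) : Prop where
  add : ∀ f g : ℝ → ℝ, T (fun x => f x + g x) = T f + T g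
  const_mul : ∀ (c : ℝ) (f : ℝ → ℝ), T (fun x => c * f x) = c * T f
  abs_sub_le : ∀ (f g : ℝ → ℝ) (ε : ℝ), (∀ x ∈ Set.Icc (0 : ℝ) 10, |f x - g x| ≤ ε) →
    |T f - T g| ≤ ε

/-- The method of moments: linearity passes from powers to polynomials, and uniform approximation on
[0, 10] from polynomials to continuous functions. -/
theorem tendsto_mean_sub_mean {α : Type*} {l : Filter α} {T T' : α → (ℝ → ℝ) → ℝ}
    (hT : ∀ᶠ i in l, IsMean (T i)) (hT' : ∀ᶠ i in l, IsMean (T' i))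
    (hpow : ∀ k : ℕ, Tendsto (fun i => T i (fun x => x ^ k) - T' i fun x => x ^ k) l (𝓝 0))
    {f : ℝ → ℝ} (hf : ContinuousOn f (Set.Icc 0 10)) :
    Tendsto (fun i => T i f - T' i f) l (𝓝 0) := by
  have hpoly : ∀ p : Polynomial ℝ,
      Tendsto (fun i => T i (fun x => p.eval x) - T' i fun x => p.eval x) l (𝓝 0) := by
    intro p
    induction p using Polynomial.induction_on' with
    | add p q hp hq =>
      have := hp.add hq
      rw [add_zero] at this
      refine this.congr' ?_
      filter_upwards [hT, hT'] with i hi hi'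
      simp only [Polynomial.eval_add]
      rw [hi.add, hi'.add]; ring
    | monomial k c =>
      have := (hpow k).const_mul c
      rw [mul_zero] at this
      refine this.congr' ?_
      filter_upwards [hT, hT'] with i hi hi'
      simp only [Polynomial.eval_monomial]
      rw [hi.const_mul, hi'.const_mul]; ring
  rw [Metric.tendsto_nhds]
  intro ε hε
  obtain ⟨p, hp⟩ := exists_polynomial_near_of_continuousOn 0 10 f hf (ε / 4) (by positivity)
  have hp' : ∀ x ∈ Set.Icc (0 : ℝ) 10, |f x - p.eval x| ≤ ε / 4 := fun x hx => by
    rw [abs_sub_comm]; exact (hp x hx).le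
  filter_upwards [hT, hT', Metric.tendsto_nhds.1 (hpoly p) (ε / 4) (by positivity)]
    with i hi hi' hlim
  rw [Real.dist_eq, sub_zero, abs_lt] at hlim
  have h1 := abs_le.1 (hi.abs_sub_le _ _ _ hp')
  have h2 := abs_le.1 (hi'.abs_sub_le _ _ _ hp')
  rw [Real.dist_eq, sub_zero, abs_lt]
  constructor <;> linarith [h1.1, h1.2, h2.1, h2.2, hlim.1, hlim.2]

/-- The same approximation shows that the means form a Cauchy sequence, so the limit need not be
known in advance. -/
theorem exists_tendsto_mean {T : ℕ → (ℝ → ℝ) → ℝ}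
    (hT : ∀ᶠ i in atTop, IsMean (T i))
    (hpow : ∀ k : ℕ, ∃ c, Tendsto (fun i => T i fun x => x ^ k) atTop (𝓝 c))
    {f : ℝ → ℝ} (hf : ContinuousOn f (Set.Icc 0 10)) :
    ∃ c, Tendsto (fun i => T i f) atTop (𝓝 c) := by
  have hpoly : ∀ p : Polynomial ℝ,
      ∃ c, Tendsto (fun i => T i fun x => p.eval x) atTop (𝓝 c) := by
    intro p
    induction p using Polynomial.induction_on' with
    | add p q hp hq =>
      obtain ⟨a, ha⟩ := hp
      obtain ⟨b, hb⟩ := hq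
      refine ⟨a + b, (ha.add hb).congr' ?_⟩
      filter_upwards [hT] with i hi
      simp only [Polynomial.eval_add]
      rw [hi.add]
    | monomial k c =>
      obtain ⟨a, ha⟩ := hpow k
      refine ⟨c * a, (ha.const_mul c).congr' ?_⟩
      filter_upwards [hT] with i hi
      simp only [Polynomial.eval_monomial]
      rw [hi.const_mul]
  apply cauchySeq_tendsto_of_complete
  rw [Metric.cauchySeq_iff']
  intro ε hε
  obtain ⟨p, hp⟩ := exists_polynomial_near_of_continuousOn 0 10 f hf (ε / 4) (by positivity)
  have hp' : ∀ x ∈ Set.Icc (0 : ℝ) 10, |f x - p.eval x| ≤ ε / 4 := fun x hx => by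
    rw [abs_sub_comm]; exact (hp x hx).le
  obtain ⟨c, hc⟩ := hpoly p
  obtain ⟨N₁, hN₁⟩ := Metric.cauchySeq_iff'.1 hc.cauchySeq (ε / 8) (by positivity)
  obtain ⟨N₂, hN₂⟩ := eventually_atTop.1 hT
  refine ⟨max N₁ N₂, fun n hn => ?_⟩
  have h1 := abs_le.1 ((hN₂ n ((le_max_right _ _).trans hn)).abs_sub_le _ _ _ hp')
  have h2 := abs_le.1 ((hN₂ _ (le_max_right N₁ N₂)).abs_sub_le _ _ _ hp')
  have h3 := hN₁ n ((le_max_left _ _).trans hn)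
  have h4 := hN₁ _ (le_max_left N₁ N₂)
  rw [Real.dist_eq, abs_lt] at h3 h4 ⊢
  constructor <;> linarith [h1.1, h1.2, h2.1, h2.2, h3.1, h3.2, h4.1, h4.2]

theorem isHermitian_laplacian {V : Type*} [Fintype V] [DecidableEq V] (G : SimpleGraph V) :
    (laplacian G).IsHermitian :=
  letI : DecidableRel G.Adj := Classical.decRel G.Adj
  (G.posSemidef_lapMatrix ℝ).isHermitian

/-- The mean of a function over the Laplacian spectrum. -/
noncomputable def spectralMean {V : Type*} [Fintype V] [DecidableEq V] (G : SimpleGraph V)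
    (f : ℝ → ℝ) : ℝ :=
  (∑ i, f ((isHermitian_laplacian G).eigenvalues₀ i)) / Fintype.card V

section
variable {V : Type*} [Fintype V] [DecidableEq V] {G : SimpleGraph V}

theorem eigenvalues₀_laplacian_nonneg (i : Fin (Fintype.card V)) :
    0 ≤ (isHermitian_laplacian G).eigenvalues₀ i := by
  have hi : (isHermitian_laplacian G).eigenvalues₀ i = (isHermitian_laplacian G).eigenvalues
      (Fintype.equivOfCardEq (Fintype.card_fin _) i) := by
    simp [Matrix.IsHermitian.eigenvalues]
  rw [hi]
  exact (@SimpleGraph.posSemidef_lapMatrix V ℝ _ G (Classical.decRel G.Adj) _ _ _ _ _ _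
    ).eigenvalues_nonneg _

theorem isMean_spectralMean [Nonempty V] (hG : RowSumsLE (laplacian G) 10) :
    IsMean (spectralMean G) where
  add f g := by simp only [spectralMean, Finset.sum_add_distrib, add_div]
  const_mul c f := by simp only [spectralMean, ← Finset.mul_sum, mul_div_assoc]
  abs_sub_le f g ε h := by
    have hN : (0 : ℝ) < Fintype.card V := by exact_mod_cast Fintype.card_pos
    rw [spectralMean, spectralMean, ← sub_div, ← Finset.sum_sub_distrib, abs_div,
      abs_of_pos hN, div_le_iff₀ hN]
    calc |∑ i, (f _ - g _)| ≤ ∑ i : Fin (Fintype.card V), ε :=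
          (Finset.abs_sum_le_sum_abs _ _).trans (Finset.sum_le_sum fun i _ =>
            h _ ⟨eigenvalues₀_laplacian_nonneg i, eigenvalues₀_le_of_rowSumsLE _ hG i⟩)
      _ = ε * Fintype.card V := by simp [mul_comm]

theorem spectralMean_pow (k : ℕ) :
    spectralMean G (fun x => x ^ k) = (laplacian G ^ k).trace / Fintype.card V := by
  rw [spectralMean, sum_eigenvalues₀_pow]

/-- The single omitted eigenvalue is at most 10; that it is in fact 0 is not needed. -/
theorem abs_laplacianEnergyLike_sub_le [Nonempty V] (hG : RowSumsLE (laplacian G) 10) :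
    |laplacianEnergyLike G / Fintype.card V - spectralMean G Real.sqrt| ≤
      √10 / Fintype.card V := by
  have hN : 0 < Fintype.card V := Fintype.card_pos
  have hN' : (0 : ℝ) < Fintype.card V := by exact_mod_cast hN
  have hdef : laplacianEnergyLike G = ∑ i : Fin (Fintype.card V) with
      i.val + 1 < Fintype.card V, √((isHermitian_laplacian G).eigenvalues₀ i) := rfl
  have hsplit := Finset.sum_filter_add_sum_filter_not Finset.univ
    (fun i : Fin (Fintype.card V) => i.val + 1 < Fintype.card V)
    (fun i => √((isHermitian_laplacian G).eigenvalues₀ i))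
  have hlast : (Finset.univ.filter fun i : Fin (Fintype.card V) =>
      ¬ i.val + 1 < Fintype.card V) = {⟨Fintype.card V - 1, by omega⟩} := by
    ext i
    simp only [Finset.mem_filter, Finset.mem_univ, true_and, Finset.mem_singleton, Fin.ext_iff]
    omega
  rw [← hdef, hlast, Finset.sum_singleton] at hsplit
  rw [spectralMean, ← sub_div, abs_div, abs_of_pos hN', ← hsplit, sub_add_cancel_left, abs_neg,
    abs_of_nonneg (Real.sqrt_nonneg _)]
  gcongr
  exact eigenvalues₀_le_of_rowSumsLE _ hG _

end

/-- The mean of a function over the spectrum of the torus, in explicit form. -/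
noncomputable def torusMean (n m : ℕ) (f : ℝ → ℝ) : ℝ :=
  (∑ t ∈ Finset.range n, ∑ l ∈ Finset.range m,
    (f (5 - 2 * Real.cos (2 * Real.pi * ((t : ℝ) / n)) - innerRoot ((t : ℝ) / n) ((l : ℝ) / m)) +
     f (5 - 2 * Real.cos (2 * Real.pi * ((t : ℝ) / n)) + innerRoot ((t : ℝ) / n) ((l : ℝ) / m)))) /
    (2 * m * n)

theorem symbol_mem_Icc (x y : ℝ) :
    5 - 2 * Real.cos (2 * Real.pi * x) - innerRoot x y ∈ Set.Icc (0 : ℝ) 10 ∧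
      5 - 2 * Real.cos (2 * Real.pi * x) + innerRoot x y ∈ Set.Icc (0 : ℝ) 10 := by
  have hR := (innerSq_nonneg (p := Real.cos (Real.pi * x)) (Real.abs_cos_le_one
    (2 * Real.pi * y + Real.pi * x))).2
  have hR0 := Real.sqrt_nonneg (innerSq (Real.cos (Real.pi * x))
    (Real.cos (2 * Real.pi * y + Real.pi * x)))
  have ha : 5 - 2 * Real.cos (2 * Real.pi * x) = 7 - 4 * Real.cos (Real.pi * x) ^ 2 := by
    rw [show 2 * Real.pi * x = 2 * (Real.pi * x) by ring, Real.cos_two_mul]; ring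
  rw [innerRoot_eq, ha]
  have hp := Real.abs_cos_le_one (Real.pi * x)
  have hp0 := abs_nonneg (Real.cos (Real.pi * x))
  have hpp := sq_abs (Real.cos (Real.pi * x))
  rw [← hpp]
  constructor <;> constructor <;> nlinarith

theorem isMean_torusMean {n m : ℕ} (hn : 0 < n) (hm : 0 < m) : IsMean (torusMean n m) where
  add f g := by
    simp only [torusMean, ← add_div, ← Finset.sum_add_distrib]
    congr 1
    exact Finset.sum_congr rfl fun _ _ => Finset.sum_congr rfl fun _ _ => by ring
  const_mul c f := by simp only [torusMean, ← mul_add, ← Finset.mul_sum, mul_div_assoc]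
  abs_sub_le f g ε h := by
    have hN : (0 : ℝ) < 2 * m * n := by positivity
    rw [torusMean, torusMean, ← sub_div, ← Finset.sum_sub_distrib, abs_div, abs_of_pos hN,
      div_le_iff₀ hN]
    simp only [← Finset.sum_sub_distrib]
    calc _ ≤ ∑ t ∈ Finset.range n, ∑ l ∈ Finset.range m, (ε + ε) := by
          refine (Finset.abs_sum_le_sum_abs _ _).trans (Finset.sum_le_sum fun t _ => ?_)
          refine (Finset.abs_sum_le_sum_abs _ _).trans (Finset.sum_le_sum fun l _ => ?_)
          rw [add_sub_add_comm]
          exact (abs_add_le _ _).trans (add_le_add (h _ (symbol_mem_Icc _ _).1)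
            (h _ (symbol_mem_Icc _ _).2))
      _ = ε * (2 * m * n) := by
          simp only [Finset.sum_const, Finset.card_range, nsmul_eq_mul]; ring

theorem card_lattice (n m : ℕ) : (Fintype.card (Fin (2 * m) × Fin n) : ℝ) = 2 * m * n := by
  simp

theorem spectralMean_torus_pow {n m : ℕ} (hn : 3 ≤ n) (hm : 2 ≤ m) (k : ℕ) :
    spectralMean (latticeToroidal n m) (fun x => x ^ k) = torusMean n m fun x => x ^ k := by
  rw [spectralMean_pow, trace_torus_pow hn hm, card_lattice]
  rfl

theorem tendsto_spectralMean_sub_torusMean_pow (vert horiz : Bool) (k : ℕ) :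
    Tendsto (fun p : ℕ × ℕ => spectralMean (lattice3342 vert horiz p.2 p.1) (fun x => x ^ k) -
      torusMean p.2 p.1 fun x => x ^ k) atTop (𝓝 0) := by
  have hlarge : ∀ᶠ p : ℕ × ℕ in atTop, 2 ≤ p.1 ∧ 3 ≤ p.2 :=
    (eventually_ge_atTop ((2, 3) : ℕ × ℕ)).mono fun p hp => hp
  have h1 : Tendsto (fun p : ℕ × ℕ => (p.1 : ℝ)) atTop atTop :=
    tendsto_natCast_atTop_atTop.comp (tendsto_fst.mono_left prod_atTop_atTop_eq.ge)
  have h2 : Tendsto (fun p : ℕ × ℕ => (p.2 : ℝ)) atTop atTop :=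
    tendsto_natCast_atTop_atTop.comp (tendsto_snd.mono_left prod_atTop_atTop_eq.ge)
  cases k with
  -- The perturbation bound covers positive exponents only; for exponent 0 both traces count the
  -- vertices.
  | zero =>
    refine tendsto_const_nhds.congr' ?_
    filter_upwards [hlarge] with p hp
    rw [← spectralMean_torus_pow hp.2 hp.1, spectralMean_pow, spectralMean_pow, pow_zero, pow_zero,
      sub_self]
  | succ k =>
    have hb : Tendsto (fun p : ℕ × ℕ => ((k : ℝ) + 1) * 10 ^ k * (40 / p.2 + 20 / p.1)) atTop
        (𝓝 (((k : ℝ) + 1) * 10 ^ k * (0 + 0))) :=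
      ((tendsto_const_nhds.div_atTop h2).add (tendsto_const_nhds.div_atTop h1)).const_mul _
    rw [add_zero, mul_zero] at hb
    refine squeeze_zero_norm' ?_ hb
    filter_upwards [hlarge] with p hp
    have hm : (0 : ℝ) < p.1 := by exact_mod_cast (by omega : 0 < p.1)
    have hn : (0 : ℝ) < p.2 := by exact_mod_cast (by omega : 0 < p.2)
    rw [← spectralMean_torus_pow hp.2 hp.1, spectralMean_pow, spectralMean_pow, ← sub_div,
      Real.norm_eq_abs, abs_div, card_lattice, abs_of_pos (by positivity : (0 : ℝ) < 2 * p.1 * p.2),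
      div_le_iff₀ (by positivity)]
    refine (abs_trace_sub_torus_le vert horiz hp.2 hp.1 k).trans (le_of_eq ?_)
    field_simp
    ring

theorem tendsto_spectralMean_sub_torusMean (vert horiz : Bool) {f : ℝ → ℝ}
    (hf : ContinuousOn f (Set.Icc 0 10)) :
    Tendsto (fun p : ℕ × ℕ => spectralMean (lattice3342 vert horiz p.2 p.1) f -
      torusMean p.2 p.1 f) atTop (𝓝 0) := by
  have hlarge : ∀ᶠ p : ℕ × ℕ in atTop, 2 ≤ p.1 ∧ 3 ≤ p.2 :=
    (eventually_ge_atTop ((2, 3) : ℕ × ℕ)).mono fun p hp => hp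
  refine tendsto_mean_sub_mean (T := fun p : ℕ × ℕ => spectralMean (lattice3342 vert horiz p.2 p.1))
    (T' := fun p : ℕ × ℕ => torusMean p.2 p.1) ?_ ?_
    (tendsto_spectralMean_sub_torusMean_pow vert horiz) hf
  · filter_upwards [hlarge] with p hp
    have : Nonempty (Fin (2 * p.1) × Fin p.2) := ⟨⟨0, by omega⟩, ⟨0, by omega⟩⟩
    exact isMean_spectralMean (rowSumsLE_laplacian_lattice3342 vert horiz hp.2 hp.1)
  · filter_upwards [hlarge] with p hp
    exact isMean_torusMean (by omega) (by omega)

/-! ### Riemann sums -/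

theorem abs_riemannSum_sub_integral_le {f : ℝ → ℝ} (hf : Continuous f) {n : ℕ} (hn : 0 < n) {ε : ℝ}
    (h : ∀ x ∈ Set.Icc (0 : ℝ) 1, ∀ y ∈ Set.Icc (0 : ℝ) 1, |x - y| ≤ 1 / n → |f x - f y| ≤ ε) :
    |(∑ t ∈ Finset.range n, f ((t : ℝ) / n)) / n - ∫ x in (0 : ℝ)..1, f x| ≤ ε := by
  have hn' : (0 : ℝ) < n := by positivity
  have hint : ∫ x in (0 : ℝ)..1, f x =
      ∑ t ∈ Finset.range n, ∫ x in ((t : ℝ) / n)..(((t + 1 : ℕ) : ℝ) / n), f x := by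
    rw [intervalIntegral.sum_integral_adjacent_intervals (a := fun t : ℕ => (t : ℝ) / n)
      fun t _ => hf.intervalIntegrable _ _]
    simp [hn'.ne']
  rw [hint, Finset.sum_div, ← Finset.sum_sub_distrib]
  calc _ ≤ ∑ t ∈ Finset.range n, ε * (1 / n) := by
        refine (Finset.abs_sum_le_sum_abs _ _).trans (Finset.sum_le_sum fun t ht => ?_)
        have htn : ((t : ℝ) + 1) ≤ n := by exact_mod_cast Finset.mem_range.1 ht
        have hle : (t : ℝ) / n ≤ ((t + 1 : ℕ) : ℝ) / n := by gcongr; simp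
        have hlen : ((t + 1 : ℕ) : ℝ) / n - (t : ℝ) / n = 1 / n := by
          push_cast; field_simp; ring
        have hc : f ((t : ℝ) / n) / n =
            ∫ _ in ((t : ℝ) / n)..(((t + 1 : ℕ) : ℝ) / n), f ((t : ℝ) / n) := by
          rw [intervalIntegral.integral_const, hlen, smul_eq_mul]; ring
        rw [hc, ← intervalIntegral.integral_sub (by simp) (hf.intervalIntegrable _ _)]
        have := intervalIntegral.norm_integral_le_of_norm_le_const (C := ε)
          (f := fun x => f ((t : ℝ) / n) - f x) (a := (t : ℝ) / n)
          (b := ((t + 1 : ℕ) : ℝ) / n) fun x hx => ?_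
        · rwa [Real.norm_eq_abs, hlen, abs_of_pos (show (0 : ℝ) < 1 / n by positivity)] at this
        · rw [Set.uIoc_of_le hle] at hx
          have h0 : 0 ≤ (t : ℝ) / n := by positivity
          have h1 : ((t + 1 : ℕ) : ℝ) / n ≤ 1 := by
            rw [div_le_one hn']; push_cast; exact htn
          refine h _ ⟨h0, hle.trans h1⟩ _ ⟨h0.trans hx.1.le, hx.2.trans h1⟩ ?_
          rw [abs_le]
          constructor <;> linarith [hx.1, hx.2]
    _ = ε := by
        rw [Finset.sum_const, Finset.card_range, nsmul_eq_mul]; field_simp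

theorem eventually_one_div_le {δ : ℝ} (hδ : 0 < δ) : ∀ᶠ n : ℕ in atTop, 0 < n ∧ 1 / (n : ℝ) < δ := by
  filter_upwards [eventually_gt_atTop 0,
    tendsto_one_div_atTop_nhds_zero_nat.eventually (gt_mem_nhds hδ)] with n h1 h2
  exact ⟨h1, h2⟩

theorem tendsto_riemannSum {f : ℝ → ℝ} (hf : Continuous f) :
    Tendsto (fun n : ℕ => (∑ t ∈ Finset.range n, f ((t : ℝ) / n)) / n) atTop
      (𝓝 (∫ x in (0 : ℝ)..1, f x)) := by
  have huc := isCompact_Icc.uniformContinuousOn_of_continuous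
    (s := Set.Icc (0 : ℝ) 1) hf.continuousOn
  rw [Metric.uniformContinuousOn_iff] at huc
  rw [Metric.tendsto_nhds]
  intro ε hε
  obtain ⟨δ, hδ, h⟩ := huc (ε / 2) (by positivity)
  filter_upwards [eventually_one_div_le hδ] with n hn
  rw [Real.dist_eq]
  refine (abs_riemannSum_sub_integral_le hf hn.1 fun x hx y hy hxy => ?_).trans_lt
    (half_lt_self hε)
  exact (h x hx y hy (hxy.trans_lt hn.2)).le

/-- Uniform continuity on the square makes the error of the inner sums independent of t, which
yields the joint limit. -/
theorem tendsto_double_riemannSum {f : ℝ → ℝ → ℝ} (hf : Continuous (Function.uncurry f)) :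
    Tendsto (fun p : ℕ × ℕ => (∑ t ∈ Finset.range p.2, ∑ l ∈ Finset.range p.1,
      f ((t : ℝ) / p.2) ((l : ℝ) / p.1)) / (p.1 * p.2)) atTop
      (𝓝 (∫ x in (0 : ℝ)..1, ∫ y in (0 : ℝ)..1, f x y)) := by
  have huc := (isCompact_Icc.prod isCompact_Icc).uniformContinuousOn_of_continuous
    (s := Set.Icc (0 : ℝ) 1 ×ˢ Set.Icc (0 : ℝ) 1) hf.continuousOn
  rw [Metric.uniformContinuousOn_iff] at huc
  rw [Metric.tendsto_nhds]
  intro ε hε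
  obtain ⟨δ, hδ, h⟩ := huc (ε / 3) (by positivity)
  rw [← prod_atTop_atTop_eq]
  filter_upwards [(eventually_one_div_le hδ).prod_mk (eventually_one_div_le hδ)] with p hp
  obtain ⟨⟨hm, hmδ⟩, hn, hnδ⟩ := hp
  have hm' : (0 : ℝ) < p.1 := by positivity
  have hn' : (0 : ℝ) < p.2 := by positivity
  have hfx : ∀ x, Continuous (f x) := fun x => hf.comp (continuous_const.prodMk continuous_id)
  set F : ℝ → ℝ := fun x => ∫ y in (0 : ℝ)..1, f x y with hF
  have hFc : Continuous F :=
    intervalIntegral.continuous_parametric_intervalIntegral_of_continuous' hf _ _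
  have h1 : |(∑ t ∈ Finset.range p.2, F ((t : ℝ) / p.2)) / p.2 - ∫ x in (0 : ℝ)..1, F x| ≤
      ε / 3 := by
    refine abs_riemannSum_sub_integral_le hFc hn fun x hx y hy hxy => ?_
    rw [hF]
    simp only
    rw [← intervalIntegral.integral_sub ((hfx x).intervalIntegrable _ _)
      ((hfx y).intervalIntegrable _ _)]
    have := intervalIntegral.norm_integral_le_of_norm_le_const (C := ε / 3)
      (f := fun z => f x z - f y z) (a := 0) (b := 1) fun z hz => ?_
    · simpa using this
    · rw [Set.uIoc_of_le zero_le_one] at hz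
      refine (h (x, z) ⟨hx, hz.1.le, hz.2⟩ (y, z) ⟨hy, hz.1.le, hz.2⟩ ?_).le
      rw [Prod.dist_eq, dist_self, max_eq_left dist_nonneg, Real.dist_eq]
      exact hxy.trans_lt hnδ
  have h2 : |(∑ t ∈ Finset.range p.2, ∑ l ∈ Finset.range p.1,
      f ((t : ℝ) / p.2) ((l : ℝ) / p.1)) / (p.1 * p.2) -
      (∑ t ∈ Finset.range p.2, F ((t : ℝ) / p.2)) / p.2| ≤ ε / 3 := by
    rw [← div_div, ← sub_div, abs_div, abs_of_pos hn', div_le_iff₀ hn', Finset.sum_div,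
      ← Finset.sum_sub_distrib]
    calc _ ≤ ∑ t ∈ Finset.range p.2, ε / 3 := by
          refine (Finset.abs_sum_le_sum_abs _ _).trans (Finset.sum_le_sum fun t ht => ?_)
          refine abs_riemannSum_sub_integral_le (hfx _) hm fun x hx y hy hxy => ?_
          have ht' : (t : ℝ) / p.2 ∈ Set.Icc (0 : ℝ) 1 := by
            refine ⟨by positivity, ?_⟩
            rw [div_le_one hn']
            exact_mod_cast (Finset.mem_range.1 ht).le
          refine (h (_, x) ⟨ht', hx⟩ (_, y) ⟨ht', hy⟩ ?_).le
          rw [Prod.dist_eq, dist_self, max_eq_right dist_nonneg, Real.dist_eq]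
          exact hxy.trans_lt hmδ
      _ = ε / 3 * p.2 := by rw [Finset.sum_const, Finset.card_range, nsmul_eq_mul, mul_comm]
  rw [Real.dist_eq]
  have h3 := abs_sub_le ((∑ t ∈ Finset.range p.2, ∑ l ∈ Finset.range p.1,
      f ((t : ℝ) / p.2) ((l : ℝ) / p.1)) / (p.1 * p.2))
      ((∑ t ∈ Finset.range p.2, F ((t : ℝ) / p.2)) / p.2) (∫ x in (0 : ℝ)..1, F x)
  linarith

/-! ### The limits -/

theorem tendsto_torusMean_sqrt :
    Tendsto (fun p : ℕ × ℕ => torusMean p.2 p.1 Real.sqrt) atTop (𝓝 limitPerVertex) := by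
  have hc : Continuous (Function.uncurry innerRoot) := by
    simp only [Function.uncurry_def, innerRoot]; fun_prop
  set A : ℝ → ℝ → ℝ := fun x y => √(5 - 2 * Real.cos (2 * Real.pi * x) - innerRoot x y) with hA
  set B : ℝ → ℝ → ℝ := fun x y => √(5 - 2 * Real.cos (2 * Real.pi * x) + innerRoot x y) with hB
  have hcos : Continuous fun z : ℝ × ℝ => 5 - 2 * Real.cos (2 * Real.pi * z.1) := by fun_prop
  have hAc : Continuous (Function.uncurry A) := (hcos.sub hc).sqrt
  have hBc : Continuous (Function.uncurry B) := (hcos.add hc).sqrt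
  have h := ((tendsto_double_riemannSum hAc).add (tendsto_double_riemannSum hBc)).const_mul
    (1 / 2 : ℝ)
  rw [mul_add] at h
  refine h.congr fun p => ?_
  simp only [torusMean, hA, hB, Finset.sum_add_distrib]
  rw [← add_div, mul_assoc 2, ← div_div _ (2 : ℝ)]
  ring

theorem tendsto_spectralMean_sqrt (vert horiz : Bool) :
    Tendsto (fun p : ℕ × ℕ => spectralMean (lattice3342 vert horiz p.2 p.1) Real.sqrt) atTop
      (𝓝 limitPerVertex) := by
  have := (tendsto_spectralMean_sub_torusMean vert horiz
    Real.continuous_sqrt.continuousOn).add tendsto_torusMean_sqrt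
  rw [zero_add] at this
  exact this.congr fun p => sub_add_cancel _ _

theorem abs_energyPerVertex_sub_le (vert horiz : Bool) {n m : ℕ} (hn : 3 ≤ n) (hm : 2 ≤ m) :
    |laplacianEnergyLike (lattice3342 vert horiz n m) / (2 * (m : ℝ) * (n : ℝ)) -
      spectralMean (lattice3342 vert horiz n m) Real.sqrt| ≤ √10 / (2 * m * n) := by
  have : Nonempty (Fin (2 * m) × Fin n) := ⟨⟨0, by omega⟩, ⟨0, by omega⟩⟩
  have h := abs_laplacianEnergyLike_sub_le (rowSumsLE_laplacian_lattice3342 vert horiz hn hm)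
  rwa [card_lattice] at h

theorem tendsto_energyPerVertex (vert horiz : Bool) :
    Tendsto (fun p : ℕ × ℕ => laplacianEnergyLike (lattice3342 vert horiz p.2 p.1) /
      (2 * (p.1 : ℝ) * (p.2 : ℝ))) atTop (𝓝 limitPerVertex) := by
  have h1 : Tendsto (fun p : ℕ × ℕ => (p.1 : ℝ)) atTop atTop :=
    tendsto_natCast_atTop_atTop.comp (tendsto_fst.mono_left prod_atTop_atTop_eq.ge)
  have h2 : Tendsto (fun p : ℕ × ℕ => (p.2 : ℝ)) atTop atTop :=
    tendsto_natCast_atTop_atTop.comp (tendsto_snd.mono_left prod_atTop_atTop_eq.ge)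
  have h3 : Tendsto (fun p : ℕ × ℕ => √10 / (2 * (p.1 : ℝ) * p.2)) atTop (𝓝 0) :=
    tendsto_const_nhds.div_atTop ((h1.const_mul_atTop two_pos).atTop_mul_atTop₀ h2)
  have h4 : Tendsto (fun p : ℕ × ℕ => laplacianEnergyLike (lattice3342 vert horiz p.2 p.1) /
      (2 * (p.1 : ℝ) * (p.2 : ℝ)) - spectralMean (lattice3342 vert horiz p.2 p.1) Real.sqrt)
      atTop (𝓝 0) := by
    refine squeeze_zero_norm' ?_ h3
    filter_upwards [eventually_ge_atTop ((2, 3) : ℕ × ℕ)] with p hp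
    exact abs_energyPerVertex_sub_le vert horiz hp.2 hp.1
  have := h4.add (tendsto_spectralMean_sqrt vert horiz)
  rw [zero_add] at this
  exact this.congr fun p => sub_add_cancel _ _

theorem continuous_columnSymbol_exp (vert : Bool) (m : ℕ) :
    Continuous fun x : ℝ => columnSymbol vert m (Complex.exp ((2 * Real.pi * x : ℝ) * Complex.I)) := by
  have h : Continuous fun x : ℝ => Complex.exp ((2 * Real.pi * x : ℝ) * Complex.I) := by fun_prop
  have h' : Continuous fun x : ℝ => (Complex.exp ((2 * Real.pi * x : ℝ) * Complex.I))⁻¹ :=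
    h.inv₀ fun x => Complex.exp_ne_zero _
  refine continuous_matrix fun r s => ?_
  simp only [columnSymbol, Matrix.of_apply]
  exact (continuous_const.sub (h.mul continuous_const)).sub (h'.mul continuous_const)

/-- At fixed m the normalized trace is a Riemann sum of the trace of a power of `columnSymbol` along
the unit circle. -/
theorem exists_tendsto_spectralMean_pow (vert : Bool) (m k : ℕ) :
    ∃ c, Tendsto (fun n => spectralMean (lattice3342 vert true n m) fun x => x ^ k) atTop (𝓝 c) := by
  set f : ℝ → ℝ := fun x =>
    ((columnSymbol vert m (Complex.exp ((2 * Real.pi * x : ℝ) * Complex.I)) ^ k).trace).re /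
      (2 * m) with hf
  have hfc : Continuous f := by
    have h := ((continuous_columnSymbol_exp vert m).pow k).matrix_trace
    exact (Complex.continuous_re.comp h).div_const _
  refine ⟨_, (tendsto_riemannSum hfc).congr' ?_⟩
  filter_upwards [eventually_ge_atTop 3] with n hn
  have : NeZero n := ⟨by omega⟩
  have h := congrArg Complex.re
    (trace_laplacian_pow vert (m := m) hn (Complex.isPrimitiveRoot_exp n (by omega)) k)
  rw [Complex.ofReal_re, Complex.re_sum] at h
  rw [spectralMean_pow, card_lattice, h, ← div_div, Finset.sum_div _ _ (2 * (m : ℝ)),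
    ← Fin.sum_univ_eq_sum_range (fun t : ℕ => f ((t : ℝ) / n))]
  congr 1
  refine Finset.sum_congr rfl fun t _ => ?_
  rw [hf, exp_root_pow]

theorem exists_tendsto_spectralMean_lattice_pow (vert horiz : Bool) {m : ℕ} (hm : 2 ≤ m) (k : ℕ) :
    ∃ c, Tendsto (fun n => spectralMean (lattice3342 vert horiz n m) fun x => x ^ k)
      atTop (𝓝 c) := by
  obtain ⟨c, hc⟩ := exists_tendsto_spectralMean_pow vert m k
  refine ⟨c, ?_⟩
  suffices h : Tendsto (fun n => spectralMean (lattice3342 vert horiz n m) (fun x => x ^ k) -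
      spectralMean (lattice3342 vert true n m) fun x => x ^ k) atTop (𝓝 0) by
    have := h.add hc
    rw [zero_add] at this
    exact this.congr fun n => sub_add_cancel _ _
  cases k with
  | zero =>
    refine tendsto_const_nhds.congr fun n => ?_
    rw [spectralMean_pow, spectralMean_pow, pow_zero, pow_zero, sub_self]
  | succ k =>
    have hb : Tendsto (fun n : ℕ => ((k : ℝ) + 1) * 10 ^ k * 40 / n) atTop (𝓝 0) :=
      tendsto_const_nhds.div_atTop tendsto_natCast_atTop_atTop
    refine squeeze_zero_norm' ?_ hb
    filter_upwards [eventually_ge_atTop 3] with n hn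
    have hm' : (0 : ℝ) < m := by exact_mod_cast (by omega : 0 < m)
    have hn' : (0 : ℝ) < n := by exact_mod_cast (by omega : 0 < n)
    rw [spectralMean_pow, spectralMean_pow, ← sub_div, Real.norm_eq_abs, abs_div, card_lattice,
      abs_of_pos (by positivity : (0 : ℝ) < 2 * m * n), div_le_iff₀ (by positivity)]
    refine (abs_trace_sub_horiz_le vert horiz hn hm k).trans (le_of_eq ?_)
    field_simp
    ring

theorem exists_tendsto_energyPerVertex (vert horiz : Bool) {m : ℕ} (hm : 2 ≤ m) :
    ∃ c, Tendsto (fun n : ℕ => laplacianEnergyLike (lattice3342 vert horiz n m) /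
      (2 * (m : ℝ) * (n : ℝ))) atTop (𝓝 c) := by
  obtain ⟨c, hc⟩ := exists_tendsto_mean
    (T := fun n => spectralMean (lattice3342 vert horiz n m)) (by
      filter_upwards [eventually_ge_atTop 3] with n hn
      have : Nonempty (Fin (2 * m) × Fin n) := ⟨⟨0, by omega⟩, ⟨0, by omega⟩⟩
      exact isMean_spectralMean (rowSumsLE_laplacian_lattice3342 vert horiz hn hm))
    (exists_tendsto_spectralMean_lattice_pow vert horiz hm) Real.continuous_sqrt.continuousOn
  have hm' : (0 : ℝ) < 2 * m := by positivity
  have h0 : Tendsto (fun n : ℕ => √10 / (2 * (m : ℝ) * n)) atTop (𝓝 0) :=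
    tendsto_const_nhds.div_atTop (tendsto_natCast_atTop_atTop.const_mul_atTop hm')
  have h1 : Tendsto (fun n : ℕ => laplacianEnergyLike (lattice3342 vert horiz n m) /
      (2 * (m : ℝ) * (n : ℝ)) - spectralMean (lattice3342 vert horiz n m) Real.sqrt)
      atTop (𝓝 0) := by
    refine squeeze_zero_norm' ?_ h0
    filter_upwards [eventually_ge_atTop 3] with n hn
    exact abs_energyPerVertex_sub_le vert horiz hn hm
  have := h1.add hc
  rw [zero_add] at this
  exact ⟨c, this.congr fun n => sub_add_cancel _ _⟩

/-- For large m, closeness to `l` for all large n passes to the inner limit. -/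
theorem hasIteratedLimit_of_tendsto {f : ℕ → ℕ → ℝ} {l : ℝ}
    (hinner : ∀ᶠ m in atTop, ∃ c, Tendsto (fun n => f m n) atTop (𝓝 c))
    (hjoint : Tendsto (fun p : ℕ × ℕ => f p.1 p.2) atTop (𝓝 l)) : HasIteratedLimit f l := by
  have hg : ∀ m, ∃ c, (∃ c, Tendsto (fun n => f m n) atTop (𝓝 c)) →
      Tendsto (fun n => f m n) atTop (𝓝 c) := fun m => by
    by_cases h : ∃ c, Tendsto (fun n => f m n) atTop (𝓝 c)
    · obtain ⟨c, hc⟩ := h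
      exact ⟨c, fun _ => hc⟩
    -- A default value, used for at most finitely many m.
    · exact ⟨0, fun h' => absurd h' h⟩
  choose g hg using hg
  refine ⟨g, hinner.mono fun m h => hg m h, ?_⟩
  rw [Metric.tendsto_nhds]
  intro ε hε
  have h1 := Metric.tendsto_nhds.1 hjoint (ε / 2) (by positivity)
  rw [← prod_atTop_atTop_eq] at h1
  filter_upwards [h1.curry, hinner] with m hm hm'
  have hlim : Tendsto (fun n => dist (f m n) l) atTop (𝓝 (dist (g m) l)) :=
    (hg m hm').dist tendsto_const_nhds
  exact (le_of_tendsto hlim (hm.mono fun n h => h.le)).trans_lt (half_lt_self hε)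

theorem hasIteratedLimit_energyPerVertex (vert horiz : Bool) :
    HasIteratedLimit (fun m n => laplacianEnergyLike (lattice3342 vert horiz n m) /
      (2 * (m : ℝ) * (n : ℝ))) limitPerVertex :=
  hasIteratedLimit_of_tendsto
    ((eventually_ge_atTop 2).mono fun _ hm => exists_tendsto_energyPerVertex vert horiz hm)
    (tendsto_energyPerVertex vert horiz)

theorem isEquivalent_energy (vert horiz : Bool) :
    (fun p : ℕ × ℕ => laplacianEnergyLike (lattice3342 vert horiz p.2 p.1)) ~[atTop]
      (fun p : ℕ × ℕ => 2 * limitPerVertex * ((p.1 : ℝ) * (p.2 : ℝ))) := by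
  -- Equivalence requires a nonzero limit; the numerical lower bound provides it.
  have hpos : 0 < limitPerVertex := by
    have := le_limitPerVertex
    linarith
  have hlarge : ∀ᶠ p : ℕ × ℕ in atTop, 1 ≤ p.1 ∧ 1 ≤ p.2 :=
    (eventually_ge_atTop ((1, 1) : ℕ × ℕ)).mono fun p hp => hp
  refine (isEquivalent_iff_tendsto_one ?_).2 ?_
  · filter_upwards [hlarge] with p hp
    have h1 : (0 : ℝ) < p.1 := by exact_mod_cast hp.1
    have h2 : (0 : ℝ) < p.2 := by exact_mod_cast hp.2
    positivity
  · have h := (tendsto_energyPerVertex vert horiz).div_const limitPerVertex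
    rw [div_self hpos.ne'] at h
    refine h.congr fun p => ?_
    rw [Pi.div_apply, div_div]
    congr 1
    ring

theorem theorem4p7 :
    -- the iterated limit per vertex exists and is the same for all boundary conditions
    (HasIteratedLimit
        (fun m n => laplacianEnergyLike (latticeToroidal n m) / (2 * (m : ℝ) * (n : ℝ)))
        limitPerVertex ∧
      HasIteratedLimit
        (fun m n => laplacianEnergyLike (latticeCylindrical n m) / (2 * (m : ℝ) * (n : ℝ)))
        limitPerVertex ∧
      HasIteratedLimit
        (fun m n => laplacianEnergyLike (latticeCylindrical' n m) / (2 * (m : ℝ) * (n : ℝ)))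
        limitPerVertex ∧
      HasIteratedLimit
        (fun m n => laplacianEnergyLike (latticeFree n m) / (2 * (m : ℝ) * (n : ℝ)))
        limitPerVertex) ∧
    -- its numerical value, to four decimals
    |limitPerVertex - 2.1525| < 0.00005 ∧
    -- the asymptotics as `m` and `n` (the pair `p` is `(m, n)`) both tend to infinity
    ((fun p : ℕ × ℕ => laplacianEnergyLike (latticeToroidal p.2 p.1)) ~[atTop]
        (fun p : ℕ × ℕ => 2 * limitPerVertex * ((p.1 : ℝ) * (p.2 : ℝ))) ∧
      (fun p : ℕ × ℕ => laplacianEnergyLike (latticeCylindrical p.2 p.1)) ~[atTop]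
        (fun p : ℕ × ℕ => 2 * limitPerVertex * ((p.1 : ℝ) * (p.2 : ℝ))) ∧
      (fun p : ℕ × ℕ => laplacianEnergyLike (latticeCylindrical' p.2 p.1)) ~[atTop]
        (fun p : ℕ × ℕ => 2 * limitPerVertex * ((p.1 : ℝ) * (p.2 : ℝ))) ∧
      (fun p : ℕ × ℕ => laplacianEnergyLike (latticeFree p.2 p.1)) ~[atTop]
        (fun p : ℕ × ℕ => 2 * limitPerVertex * ((p.1 : ℝ) * (p.2 : ℝ)))) ∧
    |2 * limitPerVertex - 4.3050| < 0.0001 := by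
  refine ⟨⟨hasIteratedLimit_energyPerVertex true true, hasIteratedLimit_energyPerVertex false true,
    hasIteratedLimit_energyPerVertex true false, hasIteratedLimit_energyPerVertex false false⟩,
    abs_limitPerVertex_sub_lt, ⟨isEquivalent_energy true true, isEquivalent_energy false true,
    isEquivalent_energy true false, isEquivalent_energy false false⟩, ?_⟩
  have h := abs_limitPerVertex_sub_lt
  rw [abs_lt] at h ⊢
  constructor <;> linarith [h.1, h.2]
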